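/- Let $d\ge 1$ and let $\mathcal X\subset\mathbb R^d$ be open and bounded with closure $\overline{\mathcal X}=\mathcal X\cup\partial\mathcal X$. Let $\Pi$ be a probability distribution on $\overline{\mathcal X}$ with density $\pi$ with respect to Lebesgue measure on $\overline{\mathcal X}$. Let $\mathcal H$ be a reproducing kernel Hilbert space of real functions on $\overline{\mathcal X}$ with kernel $k$, let $c>0$, and let $f\in L^2(\Pi)$. Write $$\mathbb S_\pi[\phi]=\nabla\cdot\phi+\phi\cdot\nabla\log\pi ,\qquad \mathcal H_+=\{\beta+\mathbb S_\pi[\phi]:\beta\in\mathbb R,\ \phi\in\mathcal H^d\},$$ $$k_0(x,x')=\nabla_x\cdot\nabla_{x'}k(x,x')+\nabla\log\pi(x)\cdot\nabla_{x'}k(x,x')+\nabla\log\pi(x')\cdot\nabla_xk(x,x')+\nabla\log\pi(x)\cdot\nabla\log\pi(x')\,k(x,x'),$$ and $k_+=c+k_0$. Assume, for some integers $a,b\ge 0$: - (A1) $\pi\in C^{a+1}(\overline{\mathcal X})$; - ($\overline{\mathrm{A2}}$) $\pi\in C^1(\overline{\mathcal X})$, $\pi>0$ on $\mathcal X$, and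 every component of $\nabla\log\pi$ belongs to $L^2(Q')$ for every probability distribution $Q'$ on $\overline{\mathcal X}$; - (A3) the mixed partial derivatives of $k$, of orders up to $b+1$ in each of its two arguments, exist and are continuous on $\overline{\mathcal X}\times\overline{\mathcal X}$; - (A4) $\pi(x)k(x,\cdot)=0$ for all $x\in\partial\mathcal X$; - (A5) $\pi>0$ on $\overline{\mathcal X}$; - (A6) $f\in\mathcal H_+$; - (A7) (interior cone condition) there are $\theta\in(0,\pi/2)$ (here $\pi$ is the number) and $r>0$ such that for every $x\in\overline{\mathcal X}$ there is a unit vector $\xi$ with $\{x+\lambda y:\|y\|_2=1,\ y^\top\xi\ge\cos\theta,\ \lambda\in[0,r]\}\subseteq\overline{\mathcal X}$. For $1\le m<n$ let $x_1,\dots,x_n$ be i.i.d. from $\Pi$, $\mathcal D_0=\{x_i\}_{i\le m}$, $\mathcal D_1=\{x_i\}_{m<i\le n}$. Let $\mathbf K_+=[k_+(x_i,x_j)]_{i,j\le m}$; let $f_m=\sum_{i\le m}\alpha_ik_+(\cdot,x_i)$ with $\mathbf K_+\alpha=(f(x_i))_{i\le m}$ if $\mathbf K_+$ is nonsingular, and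 $f_m=0$ otherwise. Put $$I_{m,n}=\frac1{n-m}\sum_{i=m+1}^n\Big(f(x_i)-\Big(f_m(x_i)-\int f_m\,d\Pi\Big)\Big),\qquad h_{\mathcal D_0}=\sup_{x\in\mathcal X}\min_{i\le m}\|x-x_i\|_2 .$$ Then $I_{m,n}$ is an unbiased estimator of $\int f\,d\Pi$, both unconditionally and conditionally on any fixed $\mathcal D_0\subset\overline{\mathcal X}$. If, moreover, for every $m$ the matrix $\mathbf K_+$ is nonsingular almost surely, then there is $h>0$ such that for every $\varepsilon>0$ there is a constant $C$ with, for all $1\le m<n$, $$\mathbb E_{\mathcal D_0}\mathbb E_{\mathcal D_1}\Big[1_{h_{\mathcal D_0}<h}\Big(I_{m,n}-\int f\,d\Pi\Big)^2\Big]\le C\,(n-m)^{-1}\,m^{-2\frac{\min(a,b)}{d}+\varepsilon}.$$ -/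

import Mathlib

open MeasureTheory Set
open scoped Classical Matrix

noncomputable section

namespace SteinCF

/-- Euclidean space `ℝ^d`. -/
abbrev Euc (d : ℕ) : Type := EuclideanSpace ℝ (Fin d)

section Calculus

/-- The `i`-th partial derivative of `g` at `x`, taken within the set `S`
(the usual partial derivative at interior points of `S`). -/
def pderiv {d : ℕ} (S : Set (Euc d)) (i : Fin d) (g : Euc d → ℝ) (x : Euc d) : ℝ :=
  fderivWithin ℝ g S x (EuclideanSpace.single i 1)

/-- Extension by zero of a function on `S`. Only its values on `S`, and its derivatives
within `S`, are ever used. -/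
def zeroExt {d : ℕ} {S : Set (Euc d)} (g : S → ℝ) (x : Euc d) : ℝ :=
  if h : x ∈ S then g ⟨x, h⟩ else 0

/-- The class `C_2^k(S)`: the mixed derivatives of `g : S × S → ℝ`, of orders up to `k` in each
of the two arguments, exist and are continuous on `S × S`. -/
structure IsC2 {d : ℕ} (k : ℕ) (S : Set (Euc d)) (g : Euc d → Euc d → ℝ) : Prop where
  diff_snd : ∀ x ∈ S, ContDiffOn ℝ k (g x) S
  diff_fst : ∀ q ≤ k, ∀ y ∈ S,
    ContDiffOn ℝ k (fun x => iteratedFDerivWithin ℝ q (g x) S y) S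
  cont : ∀ p ≤ k, ∀ q ≤ k,
    ContinuousOn
      (fun z : Euc d × Euc d =>
        iteratedFDerivWithin ℝ p (fun x => iteratedFDerivWithin ℝ q (g x) S z.2) S z.1)
      (S ×ˢ S)

end Calculus

section Stein

/-- The `i`-th component of `∇ log q` at `x`. -/
def score {d : ℕ} (S : Set (Euc d)) (q : Euc d → ℝ) (i : Fin d) (x : Euc d) : ℝ :=
  pderiv S i (fun y => Real.log (q y)) x

/-- The Stein operator `∇ · φ + φ · ∇ log q`. -/
def steinOp {d : ℕ} (S : Set (Euc d)) (q : Euc d → ℝ) (φ : Fin d → Euc d → ℝ) (x : Euc d) : ℝ :=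
  ∑ i, (pderiv S i (φ i) x + φ i x * score S q i x)

/-- The reproducing kernel `k` of a reproducing kernel Hilbert space `H` of functions on `S`. -/
def ker {d : ℕ} (S : Set (Euc d)) (H : Type*) [NormedAddCommGroup H] [InnerProductSpace ℝ H]
    [CompleteSpace H] [RKHS ℝ H S ℝ] (x y : Euc d) : ℝ :=
  zeroExt (fun u : S => zeroExt (fun v : S => RKHS.kernel H u v (1 : ℝ)) y) x

/-- The kernel `k_0` obtained from `k` by applying the Stein operator in both arguments. -/
def kZero {d : ℕ} (S : Set (Euc d)) (q : Euc d → ℝ) (k : Euc d → Euc d → ℝ) (x y : Euc d) : ℝ :=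
  ∑ i, (pderiv S i (fun u => pderiv S i (fun v => k u v) y) x
    + score S q i x * pderiv S i (fun v => k x v) y
    + score S q i y * pderiv S i (fun u => k u y) x
    + score S q i x * score S q i y * k x y)

/-- The kernel `k_+ = c + k_0`. -/
def kPlus {d : ℕ} (S : Set (Euc d)) (q : Euc d → ℝ) (k : Euc d → Euc d → ℝ) (c : ℝ)
    (x y : Euc d) : ℝ :=
  c + kZero S q k x y

/-- `f` belongs, as a function on `S`, to `H_+ = {β + S_q[φ] : β ∈ ℝ, φ ∈ H^d}`. -/
def MemHPlus {d : ℕ} (S : Set (Euc d)) (q : Euc d → ℝ) (H : Type*) [NormedAddCommGroup H]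
    [InnerProductSpace ℝ H] [CompleteSpace H] [RKHS ℝ H S ℝ] (f : Euc d → ℝ) : Prop :=
  ∃ (β : ℝ) (φ : Fin d → H), ∀ x ∈ S, f x = β + steinOp S q (fun i => zeroExt (φ i)) x

end Stein

section Assumptions

/-- The measure on `S` with density `q` with respect to Lebesgue measure on `S`. -/
def law {d : ℕ} (S : Set (Euc d)) (q : Euc d → ℝ) : Measure (Euc d) :=
  (volume.restrict S).withDensity (fun x => ENNReal.ofReal (q x))

/-- The class `Q(k)` of probability densities on `closure X`. -/
structure ClassQ {d : ℕ} (X : Set (Euc d)) (q : Euc d → ℝ) : Prop where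
  density : IsProbabilityMeasure (law (closure X) q)
  contDiff : ContDiffOn ℝ 1 q (closure X)
  pos : ∀ x ∈ X, 0 < q x
  score_memLp : ∀ Q' : Measure (Euc d), IsProbabilityMeasure Q' → Q' (closure X)ᶜ = 0 →
    ∀ i, MemLp (score (closure X) q i) 2 Q'

/-- The class `R(k)`: `q(x) k(x, ·) = 0` for all `x` in the boundary of `X`. -/
def ClassR {d : ℕ} (X : Set (Euc d)) (k : Euc d → Euc d → ℝ) (q : Euc d → ℝ) : Prop :=
  ∀ x ∈ frontier X, ∀ y ∈ closure X, q x * k x y = 0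

/-- The cone with apex `x`, axis `ξ`, angle `θ` and radius `r`. -/
def cone {d : ℕ} (x ξ : Euc d) (θ r : ℝ) : Set (Euc d) :=
  {z | ∃ (y : Euc d) (t : ℝ), ‖y‖ = 1 ∧ Real.cos θ ≤ inner ℝ y ξ ∧ t ∈ Icc 0 r ∧ z = x + t • y}

/-- The interior cone condition. -/
def InteriorCone {d : ℕ} (S : Set (Euc d)) : Prop :=
  ∃ θ ∈ Ioo 0 (Real.pi / 2), ∃ r > 0, ∀ x ∈ S, ∃ ξ : Euc d, ‖ξ‖ = 1 ∧ cone x ξ θ r ⊆ S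

end Assumptions

section Estimator

/-- The kernel matrix `[K(x_i, x_j)]` at the points `x_1, …, x_m`. -/
def gram {d m : ℕ} (K : Euc d → Euc d → ℝ) (D₀ : Fin m → Euc d) : Matrix (Fin m) (Fin m) ℝ :=
  Matrix.of fun i j => K (D₀ i) (D₀ j)

/-- The kernel interpolant `f_m` of `f` at the points `D₀`; it is `0` if the kernel matrix is
singular. -/
def interpolant {d m : ℕ} (K : Euc d → Euc d → ℝ) (f : Euc d → ℝ) (D₀ : Fin m → Euc d)
    (x : Euc d) : ℝ :=
  if IsUnit (gram K D₀).det then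
    ∑ i, ((gram K D₀)⁻¹ *ᵥ fun j => f (D₀ j)) i * K x (D₀ i)
  else 0

/-- The sample-splitting estimator with approximation `f_m` built on `D₀`, averaged over the
`l` points of `D₁`. -/
def estimator {d m l : ℕ} (P : Measure (Euc d)) (K : Euc d → Euc d → ℝ) (f : Euc d → ℝ)
    (D₀ : Fin m → Euc d) (D₁ : Fin l → Euc d) : ℝ :=
  (l : ℝ)⁻¹ * ∑ i, (f (D₁ i) - (interpolant K f D₀ (D₁ i) - ∫ x, interpolant K f D₀ x ∂P))

/-- The fill distance `sup_{x ∈ X} min_i ‖x - x_i‖`. -/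
def fillDist {d m : ℕ} (X : Set (Euc d)) (D₀ : Fin m → Euc d) : ℝ :=
  ⨆ x : X, ⨅ i : Fin m, ‖(x : Euc d) - D₀ i‖

/-- The law of `m` independent draws from `P`. -/
def iidLaw {d : ℕ} (P : Measure (Euc d)) (m : ℕ) : Measure (Fin m → Euc d) :=
  Measure.pi fun _ => P

end Estimator

end SteinCF

end

open SteinCF

namespace SteinCF

open Filter Topology Metric

/-! Everything reduces to an approximation problem for one Hilbert-space-valued map. On the interior
of S, the closure of X, the kernel `kPlus` has the feature map Φ(x) = (√c, (∂_i k_x + (∂_i log p)(x)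
k_x)_i) with values in ℝ × H^d, where k_x is the canonical feature of H, and membership in H_+ means
f(x) = ⟨F, Φ(x)⟩ for a fixed vector F (`exists_featureRep`). The interpolant is ⟨E, Φ(x)⟩ with E the
orthogonal projection of F onto the span of the Φ(x_i). Hence for all weights u the error at x is ⟨F
- E, Φ(x) - Σ u_j Φ(x_j)⟩, at most ‖F‖ ‖Φ(x) - Σ u_j Φ(x_j)‖ (`FeatureRep.abs_sub_interpolant_le`),
and u may be chosen freely.

Put s = min(a, b). The map Φ is C^s with bounded derivatives, because differentiability of a
Hilbert-valued map can be read off its Gram kernel (`exists_hasDerivAt_of_inner`). If data points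
lie near suitable reference points at distance of order R from x, there are weights of bounded ℓ¹
norm that reproduce polynomials of degree below s, and Taylor expansion gives an error O(R^s). The
cone condition leaves room for such reference points around every x with uniform constants
(`HasConeBalls.exists_isLocalDesign`). It also makes S minus its interior a null set, so almost all
points are interior.

The density is bounded below, so a reference ball at scale R is missed by all m points with
probability at most exp(-m q R^d); on that event the error is still bounded, by ‖F‖ B. Taking R
slightly larger than m^(-1/d) gives a mean square interpolation error of order m^(-2s/d + ε)
(`exists_rate`).

Given D₀, the estimator averages n - m independent copies of f - f_m, shifted by the constant ∫ f_m.
It is therefore unbiased, and its variance is at most (n - m)⁻¹ ∫ (f - f_m)²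
(`integral_sq_average_sub_le`). -/

/-! ### Geometry of the interior cone condition -/

theorem add_smul_mem_cone {d : ℕ} {x ξ v : Euc d} {θ r t : ℝ} (hθ : θ ∈ Ioo 0 (Real.pi / 2))
    (hξ : ‖ξ‖ = 1) (hv : v ∈ closedBall ((1 / 2 : ℝ) • ξ) ((1 - Real.cos θ) / 4))
    (ht : t ∈ Icc 0 r) : x + t • v ∈ cone x ξ θ r := by
  have hc0 : 0 ≤ Real.cos θ :=
    Real.cos_nonneg_of_mem_Icc ⟨by linarith [hθ.1, Real.pi_pos], hθ.2.le⟩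
  have hc1 : Real.cos θ < 1 := by
    have := Real.cos_lt_cos_of_nonneg_of_le_pi_div_two le_rfl hθ.2.le hθ.1
    simpa using this
  set c := Real.cos θ
  rw [mem_closedBall, dist_eq_norm] at hv
  set w := v - (1 / 2 : ℝ) • ξ with hw
  have hvw : v = (1 / 2 : ℝ) • ξ + w := by simp [hw]
  have hwξ : |inner ℝ w ξ| ≤ (1 - c) / 4 := by
    have := abs_real_inner_le_norm w ξ
    rw [hξ, mul_one] at this
    exact this.trans hv
  have hin : inner ℝ v ξ = 1 / 2 + inner ℝ w ξ := by
    rw [hvw, inner_add_left, real_inner_smul_left, real_inner_self_eq_norm_sq, hξ]; norm_num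
  have hnv : ‖v‖ ≤ 1 / 2 + (1 - c) / 4 := by
    rw [hvw]
    refine (norm_add_le _ _).trans ?_
    rw [norm_smul, hξ]; norm_num; linarith
  have hnv0 : 0 < ‖v‖ := by
    rw [norm_pos_iff]; rintro rfl
    rw [inner_zero_left] at hin
    have := (abs_le.1 hwξ).1
    linarith
  -- Normalise v and absorb its norm, which is below 1, into the scale. With δ = (1 - c)/4 the angle
  -- condition follows from c (1/2 + δ) ≤ 1/2 - δ, that is, (1 + c)/4 ≤ 1/2.
  refine ⟨‖v‖⁻¹ • v, t * ‖v‖, ?_, ?_, ⟨by have := ht.1; positivity, ?_⟩, ?_⟩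
  · rw [norm_smul, norm_inv, norm_norm, inv_mul_cancel₀ hnv0.ne']
  · rw [real_inner_smul_left, inv_mul_eq_div, le_div_iff₀ hnv0, hin]
    have := (abs_le.1 hwξ).1
    nlinarith
  · have := ht.2; have := ht.1
    nlinarith
  · rw [smul_smul, mul_assoc, mul_inv_cancel₀ hnv0.ne', mul_one]

theorem cone_radius_pos {θ : ℝ} (hθ : θ ∈ Ioo 0 (Real.pi / 2)) : 0 < (1 - Real.cos θ) / 4 := by
  have := Real.cos_lt_cos_of_nonneg_of_le_pi_div_two le_rfl hθ.2.le hθ.1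
  rw [Real.cos_zero] at this
  linarith

/-- A set has interior cones of size `r` and aperture `ρ`: every point `x` of the set sees a
ball of directions at a unit vector `ξ`. -/
def HasConeBalls {d : ℕ} (S : Set (Euc d)) (ρ r : ℝ) : Prop :=
  ∀ x ∈ S, ∃ ξ : Euc d, ‖ξ‖ = 1 ∧
    ∀ v ∈ closedBall ((1 / 2 : ℝ) • ξ) ρ, ∀ t ∈ Icc 0 r, x + t • v ∈ S

theorem InteriorCone.hasConeBalls {d : ℕ} {S : Set (Euc d)} (h : InteriorCone S) :
    ∃ ρ > 0, ∃ r > 0, HasConeBalls S ρ r := by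
  obtain ⟨θ, hθ, r, hr, h⟩ := h
  refine ⟨_, cone_radius_pos hθ, r, hr, fun x hx => ?_⟩
  obtain ⟨ξ, hξ, hS⟩ := h x hx
  exact ⟨ξ, hξ, fun v hv t ht => hS (add_smul_mem_cone hθ hξ hv ht)⟩

theorem ball_add_smul {d : ℕ} (x c : Euc d) {t ρ : ℝ} (ht : 0 < t) :
    ball (x + t • c) (t * ρ) = (fun v => x + t • v) '' ball c ρ := by
  ext z
  constructor
  · intro hz
    refine ⟨t⁻¹ • (z - x), ?_, by simp [smul_smul, ht.ne']⟩
    rw [mem_ball, dist_eq_norm] at hz ⊢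
    have : t⁻¹ • (z - x) - c = t⁻¹ • (z - (x + t • c)) := by
      rw [← sub_sub, smul_sub _ _ (t • c), smul_smul, inv_mul_cancel₀ ht.ne', one_smul]
    rw [this, norm_smul, norm_inv, Real.norm_of_nonneg ht.le, inv_mul_lt_iff₀ ht]
    exact hz
  · rintro ⟨v, hv, rfl⟩
    rw [mem_ball, dist_eq_norm] at hv ⊢
    have : x + t • v - (x + t • c) = t • (v - c) := by rw [smul_sub]; abel
    rw [this, norm_smul, Real.norm_of_nonneg ht.le]
    gcongr

/-- The union of segments from x to a ball of the cone is convex with nonempty interior and stays in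
S; a convex set with interior points has unique derivatives at each point of its closure. -/
theorem HasConeBalls.uniqueDiffOn {d : ℕ} {S : Set (Euc d)} {ρ r : ℝ} (hρ : 0 < ρ) (hr : 0 < r)
    (h : HasConeBalls S ρ r) : UniqueDiffOn ℝ S := by
  intro x hx
  obtain ⟨ξ, hξ, hS⟩ := h x hx
  set B := ball (x + r • ((1 / 2 : ℝ) • ξ)) (r * ρ)
  have hsub : convexHull ℝ (insert x B) ⊆ S := by
    have hBc : Convex ℝ B := convex_ball _ _
    have hBne : B.Nonempty := ⟨_, mem_ball_self (by positivity)⟩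
    rw [convexHull_insert hBne, hBc.convexHull_eq]
    intro z hz
    obtain ⟨y, hy, a, ha, b, hb, hab, rfl⟩ := by
      simpa [convexJoin, segment] using hz
    rw [show B = _ from ball_add_smul _ _ hr] at hy
    obtain ⟨v, hv, rfl⟩ := hy
    have : a • x + b • (x + r • v) = x + (b * r) • v := by
      rw [smul_add, ← add_assoc, ← add_smul, hab, one_smul, smul_smul]
    rw [this]
    exact hS v (ball_subset_closedBall hv) _ ⟨by positivity, by nlinarith⟩
  refine UniqueDiffWithinAt.mono ?_ hsub
  have hB : B ⊆ interior (convexHull ℝ (insert x B)) :=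
    interior_maximal ((subset_insert _ _).trans (subset_convexHull ℝ _)) isOpen_ball
  exact uniqueDiffWithinAt_convex (convex_convexHull ℝ _) ⟨_, hB (mem_ball_self (by positivity))⟩
    (subset_closure (subset_convexHull ℝ _ (mem_insert _ _)))

/-- Lebesgue density with off-centre balls: the cone at a point x of S contains arbitrarily small
balls, of radius comparable to their distance from x, inside the interior of S. They miss S \
interior S, so x is not a density point of that set. -/
theorem HasConeBalls.volume_diff_interior {d : ℕ} {S : Set (Euc d)} {ρ r : ℝ} (hρ : 0 < ρ)
    (hr : 0 < r) (h : HasConeBalls S ρ r) (hS : IsClosed S) :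
    volume (S \ interior S) = 0 := by
  set N := S \ interior S with hN
  have hNm : MeasurableSet N := hS.measurableSet.diff isOpen_interior.measurableSet
  have key := IsUnifLocDoublingMeasure.ae_tendsto_measure_inter_div
    (volume : Measure (Euc d)) N ρ⁻¹
  rw [ae_restrict_iff' hNm] at key
  by_contra hne
  have hfalse : ∀ᵐ x ∂(volume : Measure (Euc d)), x ∉ N := by
    filter_upwards [key] with x hx hxN
    obtain ⟨ξ, hξ, hcone⟩ := h x hxN.1
    -- Half of the available radius, so that the closed ball fits into an open ball inside S. Its
    -- centre is at distance ρ⁻¹ δ n from x, exactly what the constant ρ⁻¹ in `key` permits.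
    set δ : ℕ → ℝ := fun n => (r / (n + 1)) * (ρ / 2) with hδ
    have hδpos : ∀ n, 0 < δ n := fun n => by positivity
    have hlim : Tendsto δ atTop (𝓝[>] 0) := by
      rw [tendsto_nhdsWithin_iff]
      refine ⟨?_, Eventually.of_forall fun n => hδpos n⟩
      have := (tendsto_const_div_atTop_nhds_zero_nat r).comp (tendsto_add_atTop_nat 1)
      have := this.mul_const (ρ / 2)
      simpa [hδ, Function.comp_def] using this
    have hT := hx hxN (fun n : ℕ => x + (r / (n + 1)) • ((1 / 2 : ℝ) • ξ)) δ hlim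
      (Eventually.of_forall fun n => by
        rw [mem_closedBall, dist_eq_norm, sub_add_cancel_left, norm_neg, norm_smul, norm_smul, hξ]
        simp only [hδ]
        rw [Real.norm_of_nonneg (by positivity)]
        have : ρ⁻¹ * (r / (n + 1) * (ρ / 2)) = r / (n + 1) / 2 := by field_simp
        rw [this]; norm_num; linarith)
    have hz : ∀ n : ℕ, N ∩ closedBall (x + (r / (n + 1 : ℝ)) • ((1 / 2 : ℝ) • ξ)) (δ n) = ∅ := by
      intro n
      have hpos : 0 < r / (n + 1 : ℝ) := by positivity
      have hle : r / (n + 1 : ℝ) ≤ r := div_le_self hr.le (by linarith [n.cast_nonneg (α := ℝ)])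
      have hsub : closedBall (x + (r / (n + 1 : ℝ)) • ((1 / 2 : ℝ) • ξ)) (δ n) ⊆ interior S := by
        refine (closedBall_subset_ball (ε₂ := r / (n + 1) * ρ)
          (by simp only [hδ]; gcongr; linarith)).trans ?_
        refine interior_maximal ?_ isOpen_ball
        rw [ball_add_smul _ _ hpos]
        rintro _ ⟨v, hv, rfl⟩
        exact hcone v (ball_subset_closedBall hv) _ ⟨hpos.le, hle⟩
      rw [eq_empty_iff_forall_notMem]
      exact fun z hz => hz.1.2 (hsub hz.2)
    simp only [hz, measure_empty, ENNReal.zero_div] at hT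
    exact zero_ne_one (tendsto_nhds_unique tendsto_const_nhds hT)
  exact hne (by simpa [ae_iff] using hfalse)

/-! ### Stable local polynomial reproduction -/

/-- A functional killing every evaluation vector (q_i(y))_i would be a linear relation among the
q_i. So these vectors span and contain a basis. -/
theorem exists_det_evaluation_ne_zero {ι Y : Type*} [Fintype ι] (q : ι → Y → ℝ)
    (hq : ∀ c : ι → ℝ, (∀ y, ∑ i, c i * q i y = 0) → c = 0) :
    ∃ y : ι → Y, (Matrix.of fun i j => q i (y j)).det ≠ 0 := by
  set v : Y → ι → ℝ := fun y i => q i y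
  have hspan : Submodule.span ℝ (range v) = ⊤ := by
    by_contra hne
    obtain ⟨f, hf0, hf⟩ := Submodule.exists_le_ker_of_lt_top _ (lt_top_iff_ne_top.2 hne)
    apply hf0
    have hfv : ∀ w : ι → ℝ, f w = ∑ i, f (Pi.single i 1) * w i := fun w => by
      conv_lhs => rw [pi_eq_sum_univ' w]
      simp [mul_comm]
    have hc := hq (fun i => f (Pi.single i 1)) (fun y => by
      rw [← hfv (v y)]
      exact hf (Submodule.subset_span (mem_range_self y)))
    ext i
    simpa using congrFun hc i
  obtain ⟨κ, a, -, hsp, hli⟩ := exists_linearIndependent' ℝ v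
  let b := Module.Basis.mk hli (by rw [hsp, hspan])
  let e : ι ≃ κ := (Pi.basisFun ℝ ι).indexEquiv b
  refine ⟨a ∘ e, ?_⟩
  have hli' : LinearIndependent ℝ (v ∘ a ∘ e) := hli.comp e e.injective
  rw [← Matrix.det_transpose]
  have : IsUnit ((Matrix.of fun i j => q i ((a ∘ e) j))ᵀ) := by
    rw [← Matrix.linearIndependent_rows_iff_isUnit]
    exact hli'
  exact ((Matrix.isUnit_iff_isUnit_det _).1 this).ne_zero

/-- The monomial `y ↦ ∏ y_i ^ e_i`. -/
def monom {d s : ℕ} (e : Fin d → Fin s) (y : Euc d) : ℝ := ∏ i, y i ^ (e i : ℕ)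

theorem continuous_monom {d s : ℕ} (e : Fin d → Fin s) : Continuous (monom e) := by
  unfold monom; fun_prop

/-- The ball contains a box, and a polynomial vanishing on a product of infinite sets is zero. -/
theorem monom_linearIndependent_on_ball {d s : ℕ} (c : Euc d) {ρ : ℝ} (hρ : 0 < ρ)
    (a : (Fin d → Fin s) → ℝ) (ha : ∀ y : ball c ρ, ∑ e, a e * monom e (y : Euc d) = 0) :
    a = 0 := by
  set m : (Fin d → Fin s) → (Fin d →₀ ℕ) := fun e => Finsupp.equivFunOnFinite.symm fun i => (e i : ℕ)
  have hm : Function.Injective m := fun e e' h => by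
    funext i
    have := DFunLike.congr_fun h i
    exact Fin.ext (by simpa [m] using this)
  set p : MvPolynomial (Fin d) ℝ := ∑ e, MvPolynomial.monomial (m e) (a e)
  obtain ⟨η, hη, hball⟩ : ∃ η > 0, ∀ y : Fin d → ℝ,
      (∀ i, y i ∈ Ioo (c i - η) (c i + η)) → WithLp.toLp 2 y ∈ ball c ρ := by
    have hcont : Continuous (fun y : Fin d → ℝ => (WithLp.toLp 2 y : Euc d)) :=
      PiLp.continuous_toLp 2 _
    have : (fun y : Fin d → ℝ => (WithLp.toLp 2 y : Euc d)) ⁻¹' ball c ρ ∈ 𝓝 (WithLp.ofLp c) :=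
      hcont.continuousAt.preimage_mem_nhds (by simpa using ball_mem_nhds c hρ)
    obtain ⟨η, hη, h⟩ := Metric.mem_nhds_iff.1 this
    refine ⟨η, hη, fun y hy => h ?_⟩
    rw [mem_ball, dist_pi_lt_iff hη]
    intro i
    rw [Real.dist_eq, abs_lt]
    constructor <;> linarith [(hy i).1, (hy i).2]
  have hp : p = 0 := by
    refine MvPolynomial.funext_set (fun i => Ioo (c i - η) (c i + η))
      (fun i => Ioo_infinite (by linarith)) fun y hy => ?_
    have := ha ⟨_, hball y fun i => hy i (mem_univ i)⟩
    rw [map_zero, ← this, map_sum]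
    refine Finset.sum_congr rfl fun e _ => ?_
    rw [MvPolynomial.eval_monomial, Finsupp.prod_fintype _ _ (by simp)]
    simp [m, monom]
  funext e
  have : MvPolynomial.coeff (m e) p = a e := by
    simp only [p, MvPolynomial.coeff_sum, MvPolynomial.coeff_monomial, hm.eq_iff]
    simp
  rw [← this, hp]; simp

/-- The weights `u` at the points `y` reproduce the value at the origin of each monomial. -/
def Reproduces {d s : ℕ} (u : (Fin d → Fin s) → ℝ) (y : (Fin d → Fin s) → Euc d) : Prop :=
  ∀ e : Fin d → Fin s, ∑ j, u j * monom e (y j) = monom e 0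

/-- The solution of the linear system depends continuously on the points near z, where the
determinant stays nonzero, so its ℓ¹ norm exceeds the value at z by at most 1. -/
theorem exists_stable_weights {ι E : Type*} [Fintype ι] [PseudoMetricSpace E] (q : ι → E → ℝ)
    (hq : ∀ i, Continuous (q i)) (b : ι → ℝ) (z : ι → E)
    (hz : (Matrix.of fun i j => q i (z j)).det ≠ 0) :
    ∃ δ > 0, ∃ C : ℝ, ∀ y : ι → E, (∀ j, y j ∈ ball (z j) δ) →
      ∃ u : ι → ℝ, ∑ j, |u j| ≤ C ∧ ∀ i, ∑ j, u j * q i (y j) = b i := by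
  set M : (ι → E) → Matrix ι ι ℝ := fun y => Matrix.of fun e j => q e (y j) with hM
  have hMc : Continuous M := continuous_matrix fun e j => (hq e).comp (continuous_apply j)
  set w : (ι → E) → ι → ℝ := fun y => (M y)⁻¹ *ᵥ b with hw
  have hdet : Continuous fun y => (M y).det := hMc.matrix_det
  have hinv : ContinuousAt (fun y => (M y)⁻¹) z := by
    simp only [Matrix.inv_def, Ring.inverse_eq_inv']
    exact (hdet.continuousAt.inv₀ hz).smul hMc.matrix_adjugate.continuousAt
  have hcw : ContinuousAt w z := by
    have : Continuous fun A : Matrix ι ι ℝ => A *ᵥ b :=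
      continuous_id.matrix_mulVec continuous_const
    exact this.continuousAt.comp hinv
  have hwc : ContinuousAt (fun y => ∑ j, |w y j|) z :=
    tendsto_finsetSum _ fun j _ => ((continuous_apply j).continuousAt.comp hcw).abs
  have hev : ∀ᶠ y in 𝓝 z, (M y).det ≠ 0 ∧ ∑ j, |w y j| < ∑ j, |w z j| + 1 :=
    (hdet.continuousAt.eventually_ne hz).and (hwc.eventually_lt_const (lt_add_one _))
  obtain ⟨δ, hδ, hball⟩ := Metric.eventually_nhds_iff_ball.1 hev
  refine ⟨δ, hδ, ∑ j, |w z j| + 1, fun y hy => ?_⟩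
  obtain ⟨h1, h2⟩ := hball y (by
    rw [mem_ball, dist_pi_lt_iff hδ]; exact hy)
  refine ⟨w y, h2.le, fun e => ?_⟩
  have : M y *ᵥ w y = b := by
    rw [hw, Matrix.mulVec_mulVec, Matrix.mul_nonsing_inv _ (isUnit_iff_ne_zero.2 h1),
      Matrix.one_mulVec]
  rw [← congrFun this e]
  simp [Matrix.mulVec, dotProduct, hM, mul_comm]

theorem exists_stable_reproduction_on_ball {d : ℕ} (s : ℕ) (c : Euc d) {ρ : ℝ} (hρ : 0 < ρ) :
    ∃ y₀ : (Fin d → Fin s) → Euc d, (∀ j, y₀ j ∈ ball c ρ) ∧ ∃ δ > 0, ∃ C : ℝ,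
      ∀ y : (Fin d → Fin s) → Euc d, (∀ j, y j ∈ ball (y₀ j) δ) →
        ∃ u : (Fin d → Fin s) → ℝ, ∑ j, |u j| ≤ C ∧ Reproduces u y := by
  obtain ⟨y₀, hy₀⟩ := exists_det_evaluation_ne_zero
    (fun (e : Fin d → Fin s) (y : ball c ρ) => monom e (y : Euc d))
    (monom_linearIndependent_on_ball c hρ)
  exact ⟨fun j => y₀ j, fun j => (y₀ j).2,
    exists_stable_weights monom continuous_monom (fun e => monom e 0) (fun j => (y₀ j : Euc d)) hy₀⟩

/-- Compactness makes δ and C independent of the centre: a design built around c₀ also serves all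
centres close to c₀. -/
theorem exists_stable_reproduction {d : ℕ} (s : ℕ) {K : Set (Euc d)} (hK : IsCompact K) {ρ : ℝ}
    (hρ : 0 < ρ) : ∃ δ > 0, ∃ C : ℝ, ∀ c ∈ K, ∃ y₀ : (Fin d → Fin s) → Euc d,
      (∀ j, ball (y₀ j) δ ⊆ ball c ρ) ∧
      ∀ y : (Fin d → Fin s) → Euc d, (∀ j, y j ∈ ball (y₀ j) δ) →
        ∃ u : (Fin d → Fin s) → ℝ, ∑ j, |u j| ≤ C ∧ Reproduces u y := by
  refine hK.induction_on ?_ ?_ ?_ ?_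
  · exact ⟨1, one_pos, 0, by simp⟩
  · intro K K' hst ht
    obtain ⟨δ, hδ, C, h⟩ := ht
    exact ⟨δ, hδ, C, fun c hc => h c (hst hc)⟩
  · intro K K' hs ht
    obtain ⟨δ, hδ, C, h⟩ := hs
    obtain ⟨δ', hδ', C', h'⟩ := ht
    refine ⟨min δ δ', lt_min hδ hδ', max C C', fun c hc => ?_⟩
    rcases hc with hc | hc
    · obtain ⟨y₀, hy₀, hy⟩ := h c hc
      refine ⟨y₀, fun j => (ball_subset_ball (min_le_left _ _)).trans (hy₀ j), fun y hyj => ?_⟩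
      obtain ⟨u, hu, hr⟩ := hy y fun j => ball_subset_ball (min_le_left _ _) (hyj j)
      exact ⟨u, hu.trans (le_max_left _ _), hr⟩
    · obtain ⟨y₀, hy₀, hy⟩ := h' c hc
      refine ⟨y₀, fun j => (ball_subset_ball (min_le_right _ _)).trans (hy₀ j), fun y hyj => ?_⟩
      obtain ⟨u, hu, hr⟩ := hy y fun j => ball_subset_ball (min_le_right _ _) (hyj j)
      exact ⟨u, hu.trans (le_max_right _ _), hr⟩
  · intro c₀ _
    -- Radius ρ/4, since three distances (perturbation of the point, point to c₀, c₀ to c) must add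
    -- up to less than ρ.
    obtain ⟨y₀, hy₀, δ, hδ, C, h⟩ := exists_stable_reproduction_on_ball s c₀ (half_pos (half_pos hρ))
    refine ⟨ball c₀ (ρ / 4), mem_nhdsWithin_of_mem_nhds (ball_mem_nhds _ (by positivity)),
      min δ (ρ / 4), by positivity, C, fun c hc => ⟨y₀, fun j => ?_, fun y hy => ?_⟩⟩
    · intro z hz
      have h1 := mem_ball.1 (hy₀ j)
      have h2 := (mem_ball.1 hz).trans_le (min_le_right _ _)
      have h3 := mem_ball'.1 hc
      rw [mem_ball]
      have := dist_triangle4 z (y₀ j) c₀ c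
      linarith
    · exact h y fun j => ball_subset_ball (min_le_left _ _) (hy j)

/-! ### Taylor expansion and the error of polynomial reproduction -/

open scoped Nat in
-- One-variable Taylor formula along the segment from x to x + v; the factorial in the remainder is
-- dropped. Order zero is separate because the one-variable remainder has order n + 1.
theorem norm_sub_taylorSum_le {E G : Type*} [NormedAddCommGroup E] [NormedSpace ℝ E]
    [NormedAddCommGroup G] [NormedSpace ℝ G] {U : Set E} (hU : IsOpen U) {g : E → G} {s : ℕ}
    (hg : ContDiffOn ℝ s g U) {M : ℝ} (hM : ∀ x ∈ U, ‖iteratedFDerivWithin ℝ s g U x‖ ≤ M)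
    {x v : E} (hseg : ∀ t ∈ Icc (0 : ℝ) 1, x + t • v ∈ U) :
    ‖g (x + v) - ∑ k ∈ Finset.range s,
      (k ! : ℝ)⁻¹ • iteratedFDerivWithin ℝ k g U x (fun _ => v)‖ ≤ M * ‖v‖ ^ s := by
  have hx : x ∈ U := by simpa using hseg 0 (by simp)
  have hxv : x + v ∈ U := by simpa using hseg 1 (by simp)
  have hM0 : 0 ≤ M := (norm_nonneg _).trans (hM x hx)
  cases s with
  | zero => simpa using hM _ hxv
  | succ n =>
    let L : ℝ →ᴬ[ℝ] E := (ContinuousAffineMap.const ℝ ℝ x) +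
      (ContinuousLinearMap.toSpanSingleton ℝ v).toContinuousAffineMap
    have hL : ∀ t, L t = x + t • v := fun t => by simp [L]
    have hLc : ∀ t, L.contLinear t = t • v := fun t => by simp [L]
    have hser := ((hg.ftaylorSeriesWithin hU.uniqueDiffOn).comp_continuousAffineMap L).mono
      (show Icc (0 : ℝ) 1 ⊆ L ⁻¹' U from fun t ht => by
        rw [mem_preimage, hL]; exact hseg t ht)
    have hder : ∀ k ≤ n + 1, ∀ t ∈ Icc (0 : ℝ) 1, iteratedDerivWithin k (g ∘ L) (Icc 0 1) t
        = iteratedFDerivWithin ℝ k g U (x + t • v) (fun _ => v) := by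
      intro k hk t ht
      rw [iteratedDerivWithin, ← hser.eq_iteratedFDerivWithin_of_uniqueDiffOn (by exact_mod_cast hk)
        (uniqueDiffOn_Icc one_pos) ht]
      simp [ftaylorSeriesWithin, hL, hLc]
    have hcd : ContDiffOn ℝ ((n + 1 : ℕ) : WithTop ℕ∞) (g ∘ L) (Icc 0 1) :=
      hg.comp L.contDiff.contDiffOn fun t ht => by rw [hL]; exact hseg t ht
    have hb := taylor_mean_remainder_bound (f := g ∘ L) (a := 0) (b := 1) (C := M * ‖v‖ ^ (n + 1))
      (x := 1) (n := n) zero_le_one (by simpa only [Nat.cast_add, Nat.cast_one] using hcd) (by simp)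
      (fun t ht => by
        rw [hder _ le_rfl t ht]
        refine (ContinuousMultilinearMap.le_opNorm _ _).trans ?_
        simp only [Finset.prod_const, Finset.card_univ, Fintype.card_fin]
        gcongr
        exact hM _ (hseg t ht))
    rw [taylor_within_apply] at hb
    simp only [sub_zero, one_pow, mul_one, Function.comp_apply, hL, one_smul] at hb
    have hsum : ∑ k ∈ Finset.range (n + 1), (k ! : ℝ)⁻¹ • iteratedDerivWithin k (g ∘ L) (Icc 0 1) 0
        = ∑ k ∈ Finset.range (n + 1), (k ! : ℝ)⁻¹ • iteratedFDerivWithin ℝ k g U x (fun _ => v) := by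
      refine Finset.sum_congr rfl fun k hk => ?_
      rw [hder k (Finset.mem_range.1 hk).le 0 (by simp)]
      simp
    rw [hsum] at hb
    refine hb.trans (div_le_self (by positivity) ?_)
    exact_mod_cast Nat.one_le_iff_ne_zero.2 (Nat.factorial_ne_zero n)

/-- Expanding A(z, …, z) in coordinates produces monomials whose exponents count how often each
index occurs. These are at most k < s, so all of them are among the reproduced ones. -/
theorem Reproduces.sum_smul_map {d s k : ℕ} {G : Type*} [NormedAddCommGroup G] [NormedSpace ℝ G]
    {u : (Fin d → Fin s) → ℝ} {y : (Fin d → Fin s) → Euc d} (h : Reproduces u y) (hk : k < s)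
    (A : ContinuousMultilinearMap ℝ (fun _ : Fin k => Euc d) G) :
    ∑ j, u j • A (fun _ => y j) = A (fun _ => 0) := by
  set m : (Fin k → Fin d) → Fin d → Fin s := fun f i =>
    ⟨(Finset.univ.filter fun l => f l = i).card,
      ((Finset.card_filter_le _ _).trans (by simp)).trans_lt hk⟩
  have hexp : ∀ z : Euc d, A (fun _ => z)
      = ∑ f : Fin k → Fin d, monom (m f) z • A (fun l => EuclideanSpace.single (f l) 1) := by
    intro z
    have hz : z = ∑ i, z i • EuclideanSpace.single i (1 : ℝ) := by
      ext i; simp [Finset.sum_apply, Pi.single_apply]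
    conv_lhs => rw [hz, A.map_sum]
    refine Finset.sum_congr rfl fun f _ => ?_
    rw [A.map_smul_univ]
    congr 1
    simp only [monom, m]
    rw [← Finset.prod_fiberwise_of_maps_to (t := Finset.univ) (g := f) (by simp)]
    refine Finset.prod_congr rfl fun i _ => ?_
    rw [← Finset.prod_const]
    exact Finset.prod_congr rfl fun l hl => by rw [(Finset.mem_filter.1 hl).2]
  rw [hexp 0]
  simp only [hexp (y _), Finset.smul_sum, smul_smul]
  rw [Finset.sum_comm]
  refine Finset.sum_congr rfl fun f _ => ?_
  rw [← Finset.sum_smul, h (m f)]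

/-- The weights reproduce the Taylor polynomial at x exactly, so only remainders contribute: one at
x itself and the weighted ones at the nodes, which account for the factor 1 + C. -/
theorem Reproduces.norm_sub_sum_le {d s : ℕ} {G : Type*} [NormedAddCommGroup G] [NormedSpace ℝ G]
    {u : (Fin d → Fin s) → ℝ} {y : (Fin d → Fin s) → Euc d} (h : Reproduces u y)
    {U : Set (Euc d)} (hU : IsOpen U) {g : Euc d → G} (hg : ContDiffOn ℝ s g U) {M : ℝ}
    (hM : ∀ x ∈ U, ‖iteratedFDerivWithin ℝ s g U x‖ ≤ M) {C R : ℝ} (hC : ∑ j, |u j| ≤ C)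
    (hR : 0 ≤ R) (hy : ∀ j, ‖y j‖ ≤ 1) {x : Euc d} (hx : x ∈ U)
    (hseg : ∀ j, ∀ t ∈ Icc (0 : ℝ) 1, x + t • (R • y j) ∈ U) :
    ‖g x - ∑ j, u j • g (x + R • y j)‖ ≤ (1 + C) * M * R ^ s := by
  have hM0 : 0 ≤ M := (norm_nonneg _).trans (hM x hx)
  set P : Euc d → G := fun v => ∑ k ∈ Finset.range s,
      ((Nat.factorial k : ℕ) : ℝ)⁻¹ • iteratedFDerivWithin ℝ k g U x (fun _ => v) with hP
  have hrem : ∀ j, ‖g (x + R • y j) - P (R • y j)‖ ≤ M * R ^ s := fun j => by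
    refine (norm_sub_taylorSum_le hU hg hM (hseg j)).trans ?_
    gcongr
    rw [norm_smul, Real.norm_of_nonneg hR]
    exact mul_le_of_le_one_right hR (hy j)
  have hPsum : ∑ j, u j • P (R • y j) = P 0 := by
    simp only [hP, Finset.smul_sum]
    rw [Finset.sum_comm]
    refine Finset.sum_congr rfl fun k hk => ?_
    have hmap : ∀ j, iteratedFDerivWithin ℝ k g U x (fun _ => R • y j)
        = R ^ k • iteratedFDerivWithin ℝ k g U x (fun _ => y j) := fun j => by
      rw [ContinuousMultilinearMap.map_smul_univ _ (fun _ => R)]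
      simp
    simp only [hmap]
    have := h.sum_smul_map (Finset.mem_range.1 hk) (iteratedFDerivWithin ℝ k g U x)
    -- For k = 0 the factor is 1; for k > 0 both sides vanish.
    have hz : iteratedFDerivWithin ℝ k g U x (fun _ => (0 : Euc d))
        = R ^ k • iteratedFDerivWithin ℝ k g U x (fun _ => (0 : Euc d)) := by
      rcases Nat.eq_zero_or_pos k with rfl | hk
      · simp
      · have : Nonempty (Fin k) := ⟨⟨0, hk⟩⟩
        rw [show (fun _ : Fin k => (0 : Euc d)) = 0 from rfl, ContinuousMultilinearMap.map_zero,
          smul_zero]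
    rw [hz, ← this, Finset.smul_sum, Finset.smul_sum]
    refine Finset.sum_congr rfl fun j _ => ?_
    rw [smul_comm (u j), smul_comm (u j)]
  have hP0 : ‖g x - P 0‖ ≤ M * R ^ s := by
    rcases Nat.eq_zero_or_pos s with rfl | hs
    · simpa [hP] using hM x hx
    · have := norm_sub_taylorSum_le hU hg hM (x := x) (v := 0) (fun t _ => by simpa using hx)
      rw [add_zero, norm_zero, zero_pow hs.ne', mul_zero] at this
      exact this.trans (by positivity)
  have hsplit : g x - ∑ j, u j • g (x + R • y j)
      = (g x - P 0) - ∑ j, u j • (g (x + R • y j) - P (R • y j)) := by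
    simp only [smul_sub, Finset.sum_sub_distrib, hPsum]; abel
  rw [hsplit]
  calc _ ≤ ‖g x - P 0‖ + ∑ j, |u j| * (M * R ^ s) := by
        refine (norm_sub_le _ _).trans (add_le_add_right ?_ _)
        refine (norm_sum_le _ _).trans (Finset.sum_le_sum fun j _ => ?_)
        rw [norm_smul, Real.norm_eq_abs]
        gcongr
        exact hrem j
    _ ≤ M * R ^ s + C * (M * R ^ s) := by
        rw [← Finset.sum_mul]; gcongr
    _ = _ := by ring

/-! ### Functions with bounded derivatives -/

/-- The function `g` is of class `C^s` on `U` with bounded derivatives of orders up to `s`. -/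
structure BddContDiffOn {E G : Type*} [NormedAddCommGroup E] [NormedSpace ℝ E]
    [NormedAddCommGroup G] [NormedSpace ℝ G] (s : ℕ) (g : E → G) (U : Set E) : Prop where
  contDiffOn : ContDiffOn ℝ s g U
  bdd : ∀ k ≤ s, ∃ M, ∀ x ∈ U, ‖iteratedFDerivWithin ℝ k g U x‖ ≤ M

namespace BddContDiffOn

variable {E F G : Type*} [NormedAddCommGroup E] [NormedSpace ℝ E] [NormedAddCommGroup F]
  [NormedSpace ℝ F] [NormedAddCommGroup G] [NormedSpace ℝ G] {s : ℕ} {U : Set E}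

theorem of_le {g : E → G} (h : BddContDiffOn s g U) {t : ℕ} (ht : t ≤ s) :
    BddContDiffOn t g U :=
  ⟨h.contDiffOn.of_le (by exact_mod_cast ht), fun k hk => h.bdd k (hk.trans ht)⟩

theorem congr {g g' : E → G} (h : BddContDiffOn s g U) (hgg' : EqOn g' g U) :
    BddContDiffOn s g' U := by
  refine ⟨h.contDiffOn.congr hgg', fun k hk => ?_⟩
  obtain ⟨M, hM⟩ := h.bdd k hk
  exact ⟨M, fun x hx => by rw [iteratedFDerivWithin_congr hgg' hx]; exact hM x hx⟩

theorem clm_comp (hU : UniqueDiffOn ℝ U) {g : E → F} (h : BddContDiffOn s g U) (L : F →L[ℝ] G) :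
    BddContDiffOn s (fun x => L (g x)) U := by
  refine ⟨L.contDiff.comp_contDiffOn h.contDiffOn, fun k hk => ?_⟩
  obtain ⟨M, hM⟩ := h.bdd k hk
  refine ⟨‖L‖ * M, fun x hx => ?_⟩
  refine (L.norm_iteratedFDerivWithin_comp_left (h.contDiffOn x hx) hU hx
    (by exact_mod_cast hk)).trans ?_
  gcongr
  exact hM x hx

theorem add (hU : UniqueDiffOn ℝ U) {g g' : E → G} (h : BddContDiffOn s g U)
    (h' : BddContDiffOn s g' U) : BddContDiffOn s (fun x => g x + g' x) U := by
  refine ⟨h.contDiffOn.add h'.contDiffOn, fun k hk => ?_⟩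
  obtain ⟨M, hM⟩ := h.bdd k hk
  obtain ⟨M', hM'⟩ := h'.bdd k hk
  refine ⟨M + M', fun x hx => ?_⟩
  have hk' : (k : WithTop ℕ∞) ≤ s := by exact_mod_cast hk
  have : iteratedFDerivWithin ℝ k (fun x => g x + g' x) U x
      = iteratedFDerivWithin ℝ k g U x + iteratedFDerivWithin ℝ k g' U x :=
    iteratedFDerivWithin_add_apply ((h.contDiffOn x hx).of_le hk')
      ((h'.contDiffOn x hx).of_le hk') hU hx
  rw [this]
  exact (norm_add_le _ _).trans (add_le_add (hM x hx) (hM' x hx))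

theorem const (c : G) : BddContDiffOn s (fun _ => c) U := by
  refine ⟨contDiffOn_const, fun k _ => ?_⟩
  rcases Nat.eq_zero_or_pos k with rfl | hk
  · exact ⟨‖c‖, fun x _ => by simp⟩
  · exact ⟨0, fun x _ => by
      rw [iteratedFDerivWithin_const_of_ne hk.ne']; simp⟩

theorem sum (hU : UniqueDiffOn ℝ U) {ι : Type*} (T : Finset ι) {g : ι → E → G}
    (h : ∀ i ∈ T, BddContDiffOn s (g i) U) : BddContDiffOn s (fun x => ∑ i ∈ T, g i x) U := by
  induction T using Finset.induction_on with
  | empty => simpa using const (0 : G)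
  | insert i T hi ih =>
    simp only [Finset.sum_insert hi]
    exact (h i (Finset.mem_insert_self _ _)).add hU
      (ih fun j hj => h j (Finset.mem_insert_of_mem hj))

theorem smul (hU : UniqueDiffOn ℝ U) {c : E → ℝ} {g : E → G} (hc : BddContDiffOn s c U)
    (hg : BddContDiffOn s g U) : BddContDiffOn s (fun x => c x • g x) U := by
  refine ⟨hc.contDiffOn.smul hg.contDiffOn, fun k hk => ?_⟩
  choose! M hM using hc.bdd
  choose! M' hM' using hg.bdd
  refine ⟨∑ i ∈ Finset.range (k + 1), (k.choose i : ℝ) * M i * M' (k - i), fun x hx => ?_⟩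
  refine (norm_iteratedFDerivWithin_smul_le hc.contDiffOn hg.contDiffOn hU hx
    (by exact_mod_cast hk)).trans ?_
  refine Finset.sum_le_sum fun i hi => ?_
  have hik : i ≤ s := (Nat.lt_succ_iff.1 (Finset.mem_range.1 hi)).trans hk
  have h0 : 0 ≤ M i := (norm_nonneg _).trans (hM i hik x hx)
  gcongr
  · exact hM i hik x hx
  · exact hM' (k - i) (by omega) x hx

/-- A function of class `C^s` on a compact set `S` has bounded derivatives on its interior. -/
theorem of_isCompact {S : Set E} (hS : IsCompact S) (hSu : UniqueDiffOn ℝ S) {g : E → G}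
    (hg : ContDiffOn ℝ s g S) : BddContDiffOn s g (interior S) := by
  refine ⟨hg.mono interior_subset, fun k hk => ?_⟩
  obtain ⟨M, hM⟩ := hS.exists_bound_of_continuousOn
    (hg.continuousOn_iteratedFDerivWithin (by exact_mod_cast hk) hSu)
  refine ⟨M, fun x hx => ?_⟩
  have := iteratedFDerivWithin_inter_open (𝕜 := ℝ) (s := S) (f := g) (n := k) isOpen_interior hx
  rw [inter_eq_self_of_subset_right interior_subset] at this
  rw [this]
  exact hM x (interior_subset hx)

theorem exists_bound {g : E → G} (h : BddContDiffOn s g U) : ∃ M, ∀ x ∈ U, ‖g x‖ ≤ M := by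
  obtain ⟨M, hM⟩ := h.bdd 0 (Nat.zero_le _)
  exact ⟨M, fun x hx => by simpa using hM x hx⟩

theorem succ_of_fderivWithin (hU : UniqueDiffOn ℝ U) {g : E → G} (hg : DifferentiableOn ℝ g U)
    {M : ℝ} (hM : ∀ x ∈ U, ‖g x‖ ≤ M) (h : BddContDiffOn s (fderivWithin ℝ g U) U) :
    BddContDiffOn (s + 1) g U := by
  refine ⟨?_, fun k hk => ?_⟩
  · rw [Nat.cast_add, Nat.cast_one]
    exact contDiffOn_succ_of_fderivWithin hg (by simp) h.contDiffOn
  · cases k with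
    | zero => exact ⟨M, fun x hx => by simpa using hM x hx⟩
    | succ k =>
      obtain ⟨M', hM'⟩ := h.bdd k (by omega)
      exact ⟨M', fun x hx => by
        rw [← norm_iteratedFDerivWithin_fderivWithin hU hx]; exact hM' x hx⟩

end BddContDiffOn

/-! ### From partial derivatives to total derivatives -/

theorem _root_.HasLineDerivAt.hasDerivAt_line {E G : Type*} [NormedAddCommGroup E] [NormedSpace ℝ E]
    [NormedAddCommGroup G] [NormedSpace ℝ G] {f : E → G} {f' : G} {x v : E} {t : ℝ}
    (h : HasLineDerivAt ℝ f f' (x + t • v) v) : HasDerivAt (fun s : ℝ => f (x + s • v)) f' t := by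
  have h' : HasDerivAt (fun s : ℝ => f (x + t • v + s • v)) f' (t - t) := by
    rw [sub_self]; exact h
  have := h'.comp_sub_const t t
  refine this.congr_of_eventuallyEq (Eventually.of_forall fun s => ?_)
  simp only [sub_smul]
  congr 1
  abel

section Partial

variable {d : ℕ} {G : Type*} [NormedAddCommGroup G] [NormedSpace ℝ G]

/-- Go from x to x + v one coordinate at a time, with the mean value inequality on each leg. The
path stays in the ball because truncating coordinates of v does not increase its norm. -/
theorem norm_sub_le_of_lineDeriv_le {x : Euc d} {δ ε : ℝ} {g : Euc d → G}
    {g' : Fin d → Euc d → G}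
    (hg : ∀ z ∈ ball x δ, ∀ i, HasLineDerivAt ℝ g (g' i z) z (EuclideanSpace.single i 1))
    (hε : ∀ z ∈ ball x δ, ∀ i, ‖g' i z‖ ≤ ε) {v : Euc d} (hv : ‖v‖ < δ) :
    ‖g (x + v) - g x‖ ≤ ∑ i, ε * |v i| := by
  have key : ∀ T : Finset (Fin d),
      ‖g (x + ∑ i ∈ T, EuclideanSpace.single i (v i)) - g x‖ ≤ ∑ i ∈ T, ε * |v i| := by
    intro T
    induction T using Finset.induction_on with
    | empty => simp
    | insert i T hi ih =>
      set w := x + ∑ j ∈ T, EuclideanSpace.single j (v j) with hw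
      have hmem : ∀ t ∈ Icc (0 : ℝ) 1, w + t • EuclideanSpace.single i (v i) ∈ ball x δ := by
        intro t ht
        rw [mem_ball, dist_eq_norm, hw]
        refine lt_of_le_of_lt ?_ hv
        rw [EuclideanSpace.norm_eq, EuclideanSpace.norm_eq]
        refine Real.sqrt_le_sqrt (Finset.sum_le_sum fun j _ => ?_)
        have hco : (x + ∑ j ∈ T, EuclideanSpace.single j (v j) + t • EuclideanSpace.single i (v i)
            - x : Euc d) j = (if j ∈ T then v j else 0) + t * (if j = i then v i else 0) := by
          simp [Finset.sum_apply, Pi.single_apply, add_assoc]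
        rw [hco]
        by_cases hji : j = i
        · subst hji
          simp only [hi, if_false, if_true, zero_add, norm_mul, mul_pow]
          refine mul_le_of_le_one_left (by positivity) ?_
          rw [Real.norm_of_nonneg ht.1]
          exact pow_le_one₀ ht.1 ht.2
        · by_cases hjT : j ∈ T <;> simp [hji, hjT, sq_nonneg]
      have hder : ∀ t ∈ Icc (0 : ℝ) 1,
          HasDerivWithinAt (fun t => g (w + t • EuclideanSpace.single i (v i)))
            (v i • g' i (w + t • EuclideanSpace.single i (v i))) (Icc 0 1) t := by
        intro t ht
        have h1 := (hg _ (hmem t ht) i).smul (v i)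
        rw [show v i • EuclideanSpace.single i (1 : ℝ) = EuclideanSpace.single i (v i) by
          ext j; simp] at h1
        exact h1.hasDerivAt_line.hasDerivWithinAt
      have hmv := (convex_Icc (0 : ℝ) 1).norm_image_sub_le_of_norm_hasDerivWithin_le (C := ε * |v i|)
        hder (fun t ht => by
          rw [norm_smul, Real.norm_eq_abs, mul_comm]
          gcongr
          exact hε _ (hmem t ht) i) (left_mem_Icc.2 zero_le_one) (right_mem_Icc.2 zero_le_one)
      simp only [one_smul, zero_smul, add_zero, sub_zero, norm_one, mul_one] at hmv
      rw [Finset.sum_insert hi, Finset.sum_insert hi, add_comm (EuclideanSpace.single i (v i)),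
        ← add_assoc, ← hw]
      calc _ ≤ _ := norm_sub_le_norm_sub_add_norm_sub _ (g w) _
        _ ≤ _ := add_le_add hmv ih
  have hv' : v = ∑ i, EuclideanSpace.single i (v i) := by
    ext j; simp [Finset.sum_apply, Pi.single_apply]
  have := key Finset.univ
  rwa [← hv'] at this

/-- After subtracting the candidate derivative L, all partial derivatives are small near x, and the
preceding estimate applies. -/
theorem hasFDerivAt_of_partial {U : Set (Euc d)} (hU : IsOpen U) {g : Euc d → G}
    {g' : Fin d → Euc d → G}
    (hg : ∀ z ∈ U, ∀ i, HasLineDerivAt ℝ g (g' i z) z (EuclideanSpace.single i 1))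
    (hc : ∀ i, ContinuousOn (g' i) U) {x : Euc d} (hx : x ∈ U) :
    HasFDerivAt g (∑ i, (EuclideanSpace.proj (𝕜 := ℝ) i).smulRight (g' i x)) x := by
  set L : Euc d →L[ℝ] G := ∑ i, (EuclideanSpace.proj (𝕜 := ℝ) i).smulRight (g' i x) with hL
  have hLi : ∀ i, L (EuclideanSpace.single i 1) = g' i x := fun i => by
    simp [hL]
  rw [hasFDerivAt_iff_isLittleO_nhds_zero, Asymptotics.isLittleO_iff]
  intro ε hε
  have hev : ∀ᶠ z in 𝓝 x, z ∈ U ∧ ∀ i, ‖g' i z - g' i x‖ ≤ ε / (d + 1) := by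
    refine (hU.eventually_mem hx).and (eventually_all.2 fun i => ?_)
    have h2 : Tendsto (fun z => ‖g' i z - g' i x‖) (𝓝 x) (𝓝 0) := by
      have h1 : Tendsto (g' i) (𝓝 x) (𝓝 (g' i x)) := (hc i).continuousAt (hU.mem_nhds hx)
      simpa using (h1.sub_const (g' i x)).norm
    exact (h2.eventually_lt_const (show (0 : ℝ) < ε / (d + 1) by positivity)).mono fun _ h => h.le
  obtain ⟨δ, hδ, hball⟩ := Metric.eventually_nhds_iff_ball.1 hev
  filter_upwards [ball_mem_nhds (0 : Euc d) hδ] with v hv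
  have hder : ∀ z ∈ ball x δ, ∀ i,
      HasLineDerivAt ℝ (fun z => g z - L z) (g' i z - g' i x) z (EuclideanSpace.single i 1) := by
    intro z hz i
    have h1 := hg z (hball z hz).1 i
    have h2 := L.hasFDerivAt (x := z) |>.hasLineDerivAt (EuclideanSpace.single i 1)
    rw [hLi] at h2
    exact HasDerivAt.sub h1 h2
  have := norm_sub_le_of_lineDeriv_le hder (fun z hz i => (hball z hz).2 i) (mem_ball_zero_iff.1 hv)
  calc ‖g (x + v) - g x - L v‖ = ‖(g (x + v) - L (x + v)) - (g x - L x)‖ := by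
        rw [map_add]; congr 1; abel
    _ ≤ ∑ i : Fin d, ε / (d + 1) * |v i| := this
    _ ≤ ∑ _i : Fin d, ε / (d + 1) * ‖v‖ := by
        gcongr with i
        exact PiLp.norm_apply_le v i
    _ = ε * ‖v‖ * (d / (d + 1)) := by simp; ring
    _ ≤ ε * ‖v‖ := mul_le_of_le_one_right (by positivity)
        ((div_le_one (by positivity)).2 (by linarith))

theorem BddContDiffOn.succ_of_partial {U : Set (Euc d)} (hU : IsOpen U) {g : Euc d → G}
    {g' : Fin d → Euc d → G} {s : ℕ}
    (hg : ∀ z ∈ U, ∀ i, HasLineDerivAt ℝ g (g' i z) z (EuclideanSpace.single i 1))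
    {M : ℝ} (hM : ∀ x ∈ U, ‖g x‖ ≤ M)
    (hg' : ∀ i, BddContDiffOn s (g' i) U) : BddContDiffOn (s + 1) g U := by
  have hfd : ∀ x ∈ U, HasFDerivAt g _ x := fun x hx =>
    hasFDerivAt_of_partial hU hg (fun i => (hg' i).contDiffOn.continuousOn) hx
  refine succ_of_fderivWithin hU.uniqueDiffOn
    (fun x hx => (hfd x hx).differentiableAt.differentiableWithinAt) hM ?_
  refine BddContDiffOn.congr (g := fun x => ∑ i : Fin d, ContinuousLinearMap.smulRightL ℝ (Euc d) G
    (EuclideanSpace.proj i) (g' i x)) (sum hU.uniqueDiffOn _ fun i _ =>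
      (hg' i).clm_comp hU.uniqueDiffOn _) fun x hx => ?_
  rw [fderivWithin_of_isOpen hU hx, (hfd x hx).fderiv]
  rfl

end Partial

/-! ### Mixed derivatives and differentiability of Hilbert-valued curves -/

/-- Mean value inequality twice, after subtracting c σ τ: in σ for `φt`, then in τ for φ(s, ·) -
φ(0, ·). -/
theorem abs_second_difference_sub_le {φ φt φst : ℝ → ℝ → ℝ} {r ε c : ℝ}
    (ht : ∀ σ ∈ Ioo (-r) r, ∀ τ ∈ Ioo (-r) r, HasDerivAt (fun τ => φ σ τ) (φt σ τ) τ)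
    (hst : ∀ σ ∈ Ioo (-r) r, ∀ τ ∈ Ioo (-r) r, HasDerivAt (fun σ => φt σ τ) (φst σ τ) σ)
    (hε : ∀ σ ∈ Ioo (-r) r, ∀ τ ∈ Ioo (-r) r, |φst σ τ - c| ≤ ε) {s t : ℝ}
    (hs : s ∈ Ioo (-r) r) (htt : t ∈ Ioo (-r) r) :
    |φ s t - φ 0 t - (φ s 0 - φ 0 0) - c * s * t| ≤ ε * |s| * |t| := by
  have hr : 0 < r := by linarith [hs.1, hs.2]
  have h0 : (0 : ℝ) ∈ Ioo (-r) r := ⟨by linarith, hr⟩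
  have h1 : ∀ τ ∈ Ioo (-r) r, ‖φt s τ - φt 0 τ - c * s‖ ≤ ε * |s| := by
    intro τ hτ
    have := (convex_Ioo (-r) r).norm_image_sub_le_of_norm_hasDerivWithin_le
      (f := fun σ => φt σ τ - c * σ) (f' := fun σ => φst σ τ - c) (C := ε)
      (fun σ hσ => ((hst σ hσ τ hτ).sub (by simpa using (hasDerivAt_id σ).const_mul c)).hasDerivWithinAt)
      (fun σ hσ => hε σ hσ τ hτ) h0 hs
    simp only [mul_zero, sub_zero, Real.norm_eq_abs] at this ⊢
    convert this using 2
    ring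
  have := (convex_Ioo (-r) r).norm_image_sub_le_of_norm_hasDerivWithin_le
    (f := fun τ => φ s τ - φ 0 τ - c * s * τ) (f' := fun τ => φt s τ - φt 0 τ - c * s)
    (C := ε * |s|)
    (fun τ hτ => (((ht s hs τ hτ).sub (ht 0 h0 τ hτ)).sub
      (by simpa using (hasDerivAt_id τ).const_mul (c * s))).hasDerivWithinAt)
    h1 h0 htt
  simp only [mul_zero, sub_zero, Real.norm_eq_abs] at this
  convert this using 2
  ring

theorem exists_box_of_continuousAt {φst : ℝ → ℝ → ℝ}
    (hc : ContinuousAt (fun z : ℝ × ℝ => φst z.1 z.2) (0, 0)) {r₀ : ℝ} (hr₀ : 0 < r₀) {ε : ℝ}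
    (hε : 0 < ε) : ∃ r, 0 < r ∧ r ≤ r₀ ∧
      ∀ σ ∈ Ioo (-r) r, ∀ τ ∈ Ioo (-r) r, |φst σ τ - φst 0 0| ≤ ε := by
  obtain ⟨r, hr, h⟩ := Metric.continuousAt_iff.1 hc ε hε
  refine ⟨min r r₀, lt_min hr hr₀, min_le_right _ _, fun σ hσ τ hτ => ?_⟩
  have hσ' : |σ| < r := (abs_lt.2 hσ).trans_le (min_le_left _ _)
  have hτ' : |τ| < r := (abs_lt.2 hτ).trans_le (min_le_left _ _)
  have := h (x := (σ, τ)) (by simpa [Prod.dist_eq] using ⟨hσ', hτ'⟩)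
  exact (by simpa [Real.dist_eq] using this : |φst σ τ - φst 0 0| < ε).le

/-- Equality of mixed derivatives. -/
theorem hasDerivAt_of_mixed {φ φt φst : ℝ → ℝ → ℝ} {φs : ℝ → ℝ} {r : ℝ} (hr : 0 < r)
    (ht : ∀ σ ∈ Ioo (-r) r, ∀ τ ∈ Ioo (-r) r, HasDerivAt (fun τ => φ σ τ) (φt σ τ) τ)
    (hst : ∀ σ ∈ Ioo (-r) r, ∀ τ ∈ Ioo (-r) r, HasDerivAt (fun σ => φt σ τ) (φst σ τ) σ)
    (hs : ∀ τ ∈ Ioo (-r) r, HasDerivAt (fun σ => φ σ τ) (φs τ) 0)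
    (hc : ContinuousAt (fun z : ℝ × ℝ => φst z.1 z.2) (0, 0)) :
    HasDerivAt φs (φst 0 0) 0 := by
  rw [hasDerivAt_iff_isLittleO, Asymptotics.isLittleO_iff]
  intro ε hε
  obtain ⟨q, hq, hqr, hbox⟩ := exists_box_of_continuousAt hc hr hε
  have hsub : Ioo (-q) q ⊆ Ioo (-r) r := Ioo_subset_Ioo (by linarith) hqr
  have h0 : (0 : ℝ) ∈ Ioo (-q) q := ⟨by linarith, hq⟩
  filter_upwards [Ioo_mem_nhds h0.1 h0.2] with t htq
  have hdiff : HasDerivAt (fun σ => φ σ t - φ σ 0 - φst 0 0 * σ * t)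
      (φs t - φs 0 - φst 0 0 * t) 0 :=
    ((hs t (hsub htq)).sub (hs 0 (hsub h0))).sub
      (by simpa using ((hasDerivAt_id (0 : ℝ)).const_mul (φst 0 0)).mul_const t)
  have hlim := hasDerivAt_iff_tendsto_slope.1 hdiff
  rw [sub_zero, smul_eq_mul, mul_comm t]
  -- Divide the second-difference estimate by s and let s tend to 0.
  refine le_of_tendsto hlim.norm ?_
  filter_upwards [self_mem_nhdsWithin, mem_nhdsWithin_of_mem_nhds (Ioo_mem_nhds h0.1 h0.2)]
    with s hs0 hsq
  have := abs_second_difference_sub_le (fun σ hσ τ hτ => ht σ (hsub hσ) τ (hsub hτ))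
    (fun σ hσ τ hτ => hst σ (hsub hσ) τ (hsub hτ)) hbox hsq htq
  have hs0' : 0 < |s| := abs_pos.2 hs0
  rw [slope_def_field, Real.norm_eq_abs, abs_div, sub_zero, div_le_iff₀ hs0', Real.norm_eq_abs]
  calc _ = |φ s t - φ 0 t - (φ s 0 - φ 0 0) - φst 0 0 * s * t| := by congr 1; ring
    _ ≤ _ := this
    _ = _ := by ring

/-- A curve in a Hilbert space is differentiable if its Gram kernel has a continuous mixed
derivative. -/
theorem exists_hasDerivAt_of_inner {H : Type*} [NormedAddCommGroup H] [InnerProductSpace ℝ H]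
    [CompleteSpace H] {A : ℝ → H} {φt φst : ℝ → ℝ → ℝ} {r : ℝ} (hr : 0 < r)
    (ht : ∀ σ ∈ Ioo (-r) r, ∀ τ ∈ Ioo (-r) r,
      HasDerivAt (fun τ => inner ℝ (A σ) (A τ)) (φt σ τ) τ)
    (hst : ∀ σ ∈ Ioo (-r) r, ∀ τ ∈ Ioo (-r) r, HasDerivAt (fun σ => φt σ τ) (φst σ τ) σ)
    (hc : ContinuousAt (fun z : ℝ × ℝ => φst z.1 z.2) (0, 0)) :
    ∃ B, HasDerivAt A B 0 := by
  set q : ℝ → H := slope A 0 with hqdef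
  -- The inner product of the quotients q s and q t is a second difference of the Gram kernel over s
  -- t, hence close to `φst 0 0`. Expanding ‖q s - q t‖², the four copies of this limit cancel and
  -- leave an error of at most 4 · ε²/8.
  have hcau : Cauchy (map q (𝓝[≠] 0)) := by
    rw [Metric.cauchy_iff]
    refine ⟨inferInstance, fun ε hε => ?_⟩
    obtain ⟨p, hp, hpr, hbox⟩ := exists_box_of_continuousAt hc hr (show 0 < ε ^ 2 / 8 by positivity)
    have hsub : Ioo (-p) p ⊆ Ioo (-r) r := Ioo_subset_Ioo (by linarith) hpr
    refine ⟨q '' (Ioo (-p) p \ {0}), image_mem_map (sdiff_mem_nhdsWithin_compl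
      (Ioo_mem_nhds (by linarith) hp) _), ?_⟩
    have hin : ∀ s ∈ Ioo (-p) p \ {0}, ∀ t ∈ Ioo (-p) p \ {0},
        |inner ℝ (q s) (q t) - φst 0 0| ≤ ε ^ 2 / 8 := by
      intro s hs t htt
      have := abs_second_difference_sub_le (fun σ hσ τ hτ => ht σ (hsub hσ) τ (hsub hτ))
        (fun σ hσ τ hτ => hst σ (hsub hσ) τ (hsub hτ)) hbox hs.1 htt.1
      have hs0 : 0 < |s| := abs_pos.2 hs.2
      have ht0 : 0 < |t| := abs_pos.2 htt.2
      have hs1 : s ≠ 0 := hs.2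
      have ht1 : t ≠ 0 := htt.2
      have e : inner ℝ (q s) (q t) - φst 0 0 =
          (inner ℝ (A s) (A t) - inner ℝ (A 0) (A t) - (inner ℝ (A s) (A 0) - inner ℝ (A 0) (A 0))
            - φst 0 0 * s * t) / (s * t) := by
        simp only [hqdef, slope, vsub_eq_sub, sub_zero, real_inner_smul_left,
          real_inner_smul_right, inner_sub_left, inner_sub_right]
        field_simp
      rw [e, abs_div, abs_mul, div_le_iff₀ (by positivity)]
      linarith
    rintro _ ⟨s, hs, rfl⟩ _ ⟨t, htt, rfl⟩
    have h1 := (abs_le.1 (hin s hs s hs)).2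
    have h2 := (abs_le.1 (hin t htt t htt)).2
    have h3 := (abs_le.1 (hin s hs t htt)).1
    have h4 : ‖q s - q t‖ ^ 2 ≤ ε ^ 2 / 2 := by
      rw [@norm_sub_sq_real, ← real_inner_self_eq_norm_sq, ← real_inner_self_eq_norm_sq]
      linarith
    rw [dist_eq_norm]
    refine lt_of_pow_lt_pow_left₀ 2 hε.le (h4.trans_lt ?_)
    have : 0 < ε ^ 2 := by positivity
    linarith
  obtain ⟨B, hB⟩ := cauchy_iff_exists_le_nhds.1 hcau
  exact ⟨B, hasDerivAt_iff_tendsto_slope.2 hB⟩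

/-! ### Smoothness of a feature map from smoothness of its kernel -/

/-- `F vs ws` is the mixed partial derivative of the kernel `F [] []` on `U × U`, in the directions
`vs` in the first argument and `ws` in the second, the latter being taken first. -/
structure MixedDerivFamily {d : ℕ} (n : ℕ) (U : Set (Euc d))
    (F : List (Fin d) → List (Fin d) → Euc d → Euc d → ℝ) : Prop where
  cont : ∀ vs ws, vs.length ≤ n → ws.length ≤ n →
    ContinuousOn (fun z : Euc d × Euc d => F vs ws z.1 z.2) (U ×ˢ U)
  fst : ∀ v vs ws, vs.length < n → ws.length ≤ n → ∀ x ∈ U, ∀ y ∈ U,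
    HasLineDerivAt ℝ (fun x => F vs ws x y) (F (v :: vs) ws x y) x (EuclideanSpace.single v 1)
  snd_nil : ∀ w ws, ws.length < n → ∀ x ∈ U, ∀ y ∈ U,
    HasLineDerivAt ℝ (fun y => F [] ws x y) (F [] (w :: ws) x y) y (EuclideanSpace.single w 1)
  bdd : ∀ ws, ws.length ≤ n → ∃ M, ∀ x ∈ U, F ws ws x x ≤ M

theorem exists_Ioo_add_smul_mem {d : ℕ} {U : Set (Euc d)} (hU : IsOpen U) {x y : Euc d}
    (hx : x ∈ U) (hy : y ∈ U) (v w : Euc d) :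
    ∃ r : ℝ, 0 < r ∧ ∀ t ∈ Ioo (-r) r, x + t • v ∈ U ∧ y + t • w ∈ U := by
  have h : ∀ᶠ t : ℝ in 𝓝 0, x + t • v ∈ U ∧ y + t • w ∈ U := by
    refine Filter.Eventually.and ?_ ?_
    · exact ContinuousAt.eventually_mem (f := fun t : ℝ => x + t • v) (by fun_prop)
        (hU.mem_nhds (by simpa using hx))
    · exact ContinuousAt.eventually_mem (f := fun t : ℝ => y + t • w) (by fun_prop)
        (hU.mem_nhds (by simpa using hy))
  obtain ⟨r, hr, hb⟩ := Metric.eventually_nhds_iff_ball.1 h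
  exact ⟨r, hr, fun t ht => hb t (by rwa [Real.ball_eq_Ioo, zero_sub, zero_add])⟩

namespace MixedDerivFamily

variable {d n : ℕ} {U : Set (Euc d)} {F : List (Fin d) → List (Fin d) → Euc d → Euc d → ℝ}

theorem continuousAt_line (h : MixedDerivFamily n U F) (hU : IsOpen U) {vs ws : List (Fin d)}
    (hvs : vs.length ≤ n) (hws : ws.length ≤ n) {x y : Euc d} (hx : x ∈ U) (hy : y ∈ U)
    (v w : Euc d) :
    ContinuousAt (fun z : ℝ × ℝ => F vs ws (x + z.1 • v) (y + z.2 • w)) (0, 0) := by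
  have h1 := (h.cont vs ws hvs hws).continuousAt ((hU.prod hU).mem_nhds (mk_mem_prod hx hy))
  have h2 : ContinuousAt (fun z : ℝ × ℝ => (x + z.1 • v, y + z.2 • w)) (0, 0) := by fun_prop
  exact ContinuousAt.comp (f := fun z : ℝ × ℝ => (x + z.1 • v, y + z.2 • w))
    (g := fun z : Euc d × Euc d => F vs ws z.1 z.2) (by simpa using h1) h2

/-- The family provides second-argument derivatives only before any first-argument one. Induction on
`vs`, exchanging the two by equality of mixed derivatives, gives the rest. -/
theorem snd (h : MixedDerivFamily n U F) (hU : IsOpen U) (w : Fin d) (vs ws : List (Fin d))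
    (hvs : vs.length ≤ n) (hws : ws.length < n) : ∀ x ∈ U, ∀ y ∈ U,
    HasLineDerivAt ℝ (fun y => F vs ws x y) (F vs (w :: ws) x y) y
      (EuclideanSpace.single w 1) := by
  induction vs with
  | nil => exact h.snd_nil w ws hws
  | cons v vs ih =>
    intro x hx y hy
    have hvs' : vs.length < n := by simpa using hvs
    have hws' : (w :: ws).length ≤ n := by simpa using hws
    set ev : Euc d := EuclideanSpace.single v 1
    set ew : Euc d := EuclideanSpace.single w 1
    obtain ⟨r, hr, hr'⟩ := exists_Ioo_add_smul_mem hU hx hy ev ew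
    have := hasDerivAt_of_mixed (φ := fun σ τ => F vs ws (x + σ • ev) (y + τ • ew))
      (φt := fun σ τ => F vs (w :: ws) (x + σ • ev) (y + τ • ew))
      (φst := fun σ τ => F (v :: vs) (w :: ws) (x + σ • ev) (y + τ • ew))
      (φs := fun τ => F (v :: vs) ws x (y + τ • ew)) hr
      (fun σ hσ τ hτ => (ih hvs'.le _ (hr' σ hσ).1 _ (hr' τ hτ).2).hasDerivAt_line)
      (fun σ hσ τ hτ => (h.fst v vs (w :: ws) hvs' hws' _ (hr' σ hσ).1 _
        (hr' τ hτ).2).hasDerivAt_line)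
      (fun τ hτ => h.fst v vs ws hvs' hws.le x hx _ (hr' τ hτ).2)
      (h.continuousAt_line hU hvs hws' hx hy ev ew)
    simpa [HasLineDerivAt] using this

end MixedDerivFamily

/-- Iterated partial derivatives. -/
noncomputable def iterPartial {d : ℕ} {G : Type*} [NormedAddCommGroup G] [NormedSpace ℝ G] (g : Euc d → G) :
    List (Fin d) → Euc d → G
  | [] => g
  | i :: l => fun x => lineDeriv ℝ (iterPartial g l) x (EuclideanSpace.single i 1)

namespace MixedDerivFamily

variable {d n : ℕ} {U : Set (Euc d)} {F : List (Fin d) → List (Fin d) → Euc d → Euc d → ℝ}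
  {H : Type*} [NormedAddCommGroup H] [InnerProductSpace ℝ H] [CompleteSpace H] {Φ : Euc d → H}

/-- The Gram kernel of the curve t ↦ `iterPartial Φ ws (x + t • e)` is `F ws ws`, with continuous
mixed derivative `F (w :: ws) (w :: ws)`. So the derivative exists, and `lineDeriv` is not its
default value. -/
theorem hasLineDerivAt_of_inner (h : MixedDerivFamily n U F) (hU : IsOpen U) {ws : List (Fin d)}
    (hws : ws.length < n)
    (hin : ∀ x ∈ U, ∀ y ∈ U, inner ℝ (iterPartial Φ ws x) (iterPartial Φ ws y) = F ws ws x y)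
    (w : Fin d) {x : Euc d} (hx : x ∈ U) :
    HasLineDerivAt ℝ (iterPartial Φ ws) (iterPartial Φ (w :: ws) x) x
      (EuclideanSpace.single w 1) := by
  set e : Euc d := EuclideanSpace.single w 1 with he
  obtain ⟨r, hr, hr'⟩ := exists_Ioo_add_smul_mem hU hx hx e e
  obtain ⟨B, hB⟩ := exists_hasDerivAt_of_inner (A := fun t => iterPartial Φ ws (x + t • e))
    (φt := fun σ τ => F ws (w :: ws) (x + σ • e) (x + τ • e))
    (φst := fun σ τ => F (w :: ws) (w :: ws) (x + σ • e) (x + τ • e)) hr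
    (fun σ hσ τ hτ => by
      have h1 := (h.snd hU w ws ws hws.le hws _ (hr' σ hσ).1 _ (hr' τ hτ).2).hasDerivAt_line
      refine h1.congr_of_eventuallyEq ?_
      filter_upwards [Ioo_mem_nhds hτ.1 hτ.2] with τ' hτ'
      exact hin _ (hr' σ hσ).1 _ (hr' τ' hτ').1)
    (fun σ hσ τ hτ => (h.fst w ws (w :: ws) hws (by simpa using hws) _ (hr' σ hσ).1 _
        (hr' τ hτ).2).hasDerivAt_line)
    (h.continuousAt_line hU (by simpa using hws) (by simpa using hws) hx hx e e)
  have hB' : HasLineDerivAt ℝ (iterPartial Φ ws) B x e := hB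
  have : iterPartial Φ (w :: ws) x = B := hB'.lineDeriv
  rw [this]
  exact hB'

/-- Induction on the order: the identity at order m yields the derivatives of order m + 1, after
which the inner product is differentiated in the second slot (`hright`) and then in the first. -/
theorem inner_iterPartial (h : MixedDerivFamily n U F) (hU : IsOpen U)
    (hΦ : ∀ x ∈ U, ∀ y ∈ U, inner ℝ (Φ x) (Φ y) = F [] [] x y) (m : ℕ) (hm : m ≤ n) :
    ∀ vs ws : List (Fin d), vs.length ≤ m → ws.length ≤ m → ∀ x ∈ U, ∀ y ∈ U,
      inner ℝ (iterPartial Φ vs x) (iterPartial Φ ws y) = F vs ws x y := by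
  induction m with
  | zero =>
    intro vs ws hvs hws
    rw [Nat.le_zero, List.length_eq_zero_iff] at hvs hws
    subst hvs hws
    exact hΦ
  | succ m ih =>
    have ih := ih (by omega)
    have hder : ∀ ws : List (Fin d), ws.length ≤ m → ∀ w, ∀ x ∈ U,
        HasLineDerivAt ℝ (iterPartial Φ ws) (iterPartial Φ (w :: ws) x) x
          (EuclideanSpace.single w 1) := fun ws hws w x hx =>
      h.hasLineDerivAt_of_inner hU (by omega) (ih ws ws hws hws) w hx
    have hright : ∀ vs ws : List (Fin d), vs.length ≤ m → ws.length ≤ m + 1 → ∀ x ∈ U, ∀ y ∈ U,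
        inner ℝ (iterPartial Φ vs x) (iterPartial Φ ws y) = F vs ws x y := by
      intro vs ws hvs hws x hx y hy
      cases ws with
      | nil => exact ih vs [] hvs (by simp) x hx y hy
      | cons w ws =>
        have hws : ws.length ≤ m := by simpa using hws
        set e : Euc d := EuclideanSpace.single w 1
        obtain ⟨r, hr, hr'⟩ := exists_Ioo_add_smul_mem hU hy hy e e
        have h1 : HasDerivAt (fun t : ℝ => inner ℝ (iterPartial Φ vs x) (iterPartial Φ ws (y + t • e)))
            (inner ℝ (iterPartial Φ vs x) (iterPartial Φ (w :: ws) y)) 0 :=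
          (innerSL ℝ (iterPartial Φ vs x)).hasFDerivAt.comp_hasDerivAt 0 (hder ws hws w y hy)
        have h2 : HasDerivAt (fun t : ℝ => F vs ws x (y + t • e)) (F vs (w :: ws) x y) 0 :=
          h.snd hU w vs ws (by omega) (by omega) x hx y hy
        refine h1.unique (h2.congr_of_eventuallyEq ?_)
        filter_upwards [Ioo_mem_nhds (neg_lt_zero.2 hr) hr] with t ht
        exact ih vs ws hvs hws x hx _ (hr' t ht).1
    intro vs ws hvs hws x hx y hy
    cases vs with
    | nil => exact hright [] ws (by simp) hws x hx y hy
    | cons v vs =>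
      have hvs : vs.length ≤ m := by simpa using hvs
      set e : Euc d := EuclideanSpace.single v 1
      obtain ⟨r, hr, hr'⟩ := exists_Ioo_add_smul_mem hU hx hx e e
      have h1 : HasDerivAt (fun t : ℝ => inner ℝ (iterPartial Φ ws y) (iterPartial Φ vs (x + t • e)))
          (inner ℝ (iterPartial Φ ws y) (iterPartial Φ (v :: vs) x)) 0 :=
        (innerSL ℝ (iterPartial Φ ws y)).hasFDerivAt.comp_hasDerivAt 0 (hder vs hvs v x hx)
      have h2 : HasDerivAt (fun t : ℝ => F vs ws (x + t • e) y) (F (v :: vs) ws x y) 0 :=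
        h.fst v vs ws (by omega) (by omega) x hx y hy
      rw [real_inner_comm]
      refine h1.unique (h2.congr_of_eventuallyEq ?_)
      filter_upwards [Ioo_mem_nhds (neg_lt_zero.2 hr) hr] with t ht
      rw [real_inner_comm]
      exact hright vs ws hvs hws _ (hr' t ht).1 y hy

/-- Bounds come from the kernel on the diagonal, continuity from ‖Ψ(x) - Ψ(x₀)‖² = F(x,x) - 2F(x,x₀)
+ F(x₀,x₀), and higher orders from the partial derivatives, by induction on j. -/
theorem bddContDiffOn_iterPartial (h : MixedDerivFamily n U F) (hU : IsOpen U)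
    (hΦ : ∀ x ∈ U, ∀ y ∈ U, inner ℝ (Φ x) (Φ y) = F [] [] x y) (j : ℕ) :
    ∀ ws : List (Fin d), ws.length + j ≤ n → BddContDiffOn j (iterPartial Φ ws) U := by
  have hin := h.inner_iterPartial hU hΦ n le_rfl
  have hb : ∀ ws : List (Fin d), ws.length ≤ n → ∃ M, ∀ x ∈ U, ‖iterPartial Φ ws x‖ ≤ M := by
    intro ws hws
    obtain ⟨M, hM⟩ := h.bdd ws hws
    refine ⟨√M, fun x hx => Real.le_sqrt_of_sq_le ?_⟩
    rw [← real_inner_self_eq_norm_sq, hin ws ws hws hws x hx x hx]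
    exact hM x hx
  induction j with
  | zero =>
    intro ws hws
    have hws : ws.length ≤ n := by simpa using hws
    refine ⟨?_, fun k hk => ?_⟩
    · rw [Nat.cast_zero, contDiffOn_zero]
      intro x₀ hx₀
      refine ContinuousAt.continuousWithinAt ?_
      rw [ContinuousAt, tendsto_iff_norm_sub_tendsto_zero]
      have hF := h.cont ws ws hws hws
      have hx₀' := hU.mem_nhds hx₀
      have hat : ∀ x ∈ U, ∀ y ∈ U, ContinuousAt (fun z : Euc d × Euc d => F ws ws z.1 z.2) (x, y) :=
        fun x hx y hy => hF.continuousAt ((hU.prod hU).mem_nhds (mk_mem_prod hx hy))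
      have c1 : ContinuousAt (fun x => F ws ws x x) x₀ :=
        ContinuousAt.comp (f := fun x : Euc d => (x, x)) (hat x₀ hx₀ x₀ hx₀) (by fun_prop)
      have c2 : ContinuousAt (fun x => F ws ws x x₀) x₀ :=
        ContinuousAt.comp (f := fun x : Euc d => (x, x₀)) (hat x₀ hx₀ x₀ hx₀) (by fun_prop)
      have c3 : Tendsto (fun x => √(F ws ws x x - 2 * F ws ws x x₀ + F ws ws x₀ x₀)) (𝓝 x₀) (𝓝 0) := by
        have := ((c1.tendsto.sub (c2.tendsto.const_mul 2)).add_const (F ws ws x₀ x₀)).sqrt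
        convert this using 2
        rw [show F ws ws x₀ x₀ - 2 * F ws ws x₀ x₀ + F ws ws x₀ x₀ = 0 by ring, Real.sqrt_zero]
      refine c3.congr' ?_
      filter_upwards [hx₀'] with x hx
      rw [← Real.sqrt_sq (norm_nonneg (iterPartial Φ ws x - iterPartial Φ ws x₀)),
        @norm_sub_sq_real, ← real_inner_self_eq_norm_sq, ← real_inner_self_eq_norm_sq,
        hin ws ws hws hws x hx x hx, hin ws ws hws hws x hx x₀ hx₀,
        hin ws ws hws hws x₀ hx₀ x₀ hx₀]
    · obtain rfl : k = 0 := by omega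
      obtain ⟨M, hM⟩ := hb ws hws
      exact ⟨M, fun x hx => by simpa using hM x hx⟩
  | succ j ih =>
    intro ws hws
    obtain ⟨M, hM⟩ := hb ws (by omega)
    exact BddContDiffOn.succ_of_partial hU (g' := fun w => iterPartial Φ (w :: ws))
      (fun x hx w => h.hasLineDerivAt_of_inner hU (by omega)
        (hin ws ws (by omega) (by omega)) w hx) hM
      (fun w => ih (w :: ws) (by simp; omega))

end MixedDerivFamily

/-- The coordinate directions listed by `l`. -/
noncomputable def coordDirs {d : ℕ} (l : List (Fin d)) : Fin l.length → Euc d :=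
  fun j => EuclideanSpace.single (l.get j) 1

/-- The mixed partial derivatives, within `S`, of a kernel. -/
noncomputable def mixedDeriv {d : ℕ} (S : Set (Euc d)) (k : Euc d → Euc d → ℝ)
    (vs ws : List (Fin d)) (x y : Euc d) : ℝ :=
  iteratedFDerivWithin ℝ vs.length (fun x => iteratedFDerivWithin ℝ ws.length (k x) S y) S x
    (coordDirs vs) (coordDirs ws)

theorem hasLineDerivAt_iteratedFDerivWithin {E G : Type*} [NormedAddCommGroup E] [NormedSpace ℝ E]
    [NormedAddCommGroup G] [NormedSpace ℝ G] {S : Set E} (hS : UniqueDiffOn ℝ S) {n p : ℕ}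
    (hp : p < n) {f : E → G} (hf : ContDiffOn ℝ n f S) {x : E} (hx : x ∈ interior S)
    (m : Fin (p + 1) → E) :
    HasLineDerivAt ℝ (fun x => iteratedFDerivWithin ℝ p f S x (Fin.tail m))
      (iteratedFDerivWithin ℝ (p + 1) f S x m) x (m 0) := by
  rw [iteratedFDerivWithin_succ_apply_left]
  have hn : S ∈ 𝓝 x := mem_interior_iff_mem_nhds.1 hx
  have hd : DifferentiableAt ℝ (iteratedFDerivWithin ℝ p f S) x :=
    ((hf.differentiableOn_iteratedFDerivWithin (by exact_mod_cast hp) hS) x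
      (interior_subset hx)).differentiableAt hn
  rw [fderivWithin_of_mem_nhds hn]
  have h1 := (ContinuousMultilinearMap.apply ℝ (fun _ : Fin p => E) G
    (Fin.tail m)).hasFDerivAt.comp x hd.hasFDerivAt
  exact h1.hasLineDerivAt (m 0)

theorem IsC2.mixedDerivFamily {d n : ℕ} {S : Set (Euc d)} (hS : UniqueDiffOn ℝ S)
    (hSc : IsCompact S) {k : Euc d → Euc d → ℝ} (hk : IsC2 n S k) :
    MixedDerivFamily n (interior S) (mixedDeriv S k) := by
  have hcont : ∀ vs ws : List (Fin d), vs.length ≤ n → ws.length ≤ n →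
      ContinuousOn (fun z : Euc d × Euc d => mixedDeriv S k vs ws z.1 z.2) (S ×ˢ S) := by
    intro vs ws hvs hws
    exact (ContinuousMultilinearMap.apply ℝ _ _ (coordDirs ws)).continuous.comp_continuousOn
      ((ContinuousMultilinearMap.apply ℝ _ _ (coordDirs vs)).continuous.comp_continuousOn
        (hk.cont _ hvs _ hws))
  refine ⟨fun vs ws hvs hws => (hcont vs ws hvs hws).mono
    (prod_mono interior_subset interior_subset), ?_, ?_, ?_⟩
  · intro v vs ws hvs hws x hx y hy
    have := hasLineDerivAt_iteratedFDerivWithin hS hvs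
      (hk.diff_fst _ hws y (interior_subset hy)) hx (coordDirs (v :: vs))
    exact (ContinuousMultilinearMap.apply ℝ (fun _ : Fin ws.length => Euc d) ℝ
      (coordDirs ws)).hasFDerivAt.comp_hasDerivAt 0 this
  · intro w ws hws x hx y hy
    simp only [mixedDeriv, List.length_nil, iteratedFDerivWithin_zero_apply]
    exact hasLineDerivAt_iteratedFDerivWithin hS hws (hk.diff_snd x (interior_subset hx)) hy
      (coordDirs (w :: ws))
  · intro ws hws
    obtain ⟨M, hM⟩ := (hSc.prod hSc).exists_bound_of_continuousOn (hcont ws ws hws hws)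
    exact ⟨M, fun x hx => (le_abs_self _).trans
      (hM (x, x) (mk_mem_prod (interior_subset hx) (interior_subset hx)))⟩

/-! ### Feature maps of k and of the Stein kernel -/

theorem pderiv_inner {d : ℕ} {S : Set (Euc d)} {H : Type*} [NormedAddCommGroup H]
    [InnerProductSpace ℝ H] {Φ : Euc d → H} {x : Euc d} (hx : x ∈ interior S)
    (hΦ : DifferentiableAt ℝ Φ x) (φ : H) (i : Fin d) :
    pderiv S i (fun u => inner ℝ φ (Φ u)) x
      = inner ℝ φ (lineDeriv ℝ Φ x (EuclideanSpace.single i 1)) := by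
  rw [pderiv, fderivWithin_of_mem_nhds (mem_interior_iff_mem_nhds.1 hx)]
  have : HasFDerivAt (fun u => inner ℝ φ (Φ u)) ((innerSL ℝ φ).comp (fderiv ℝ Φ x)) x :=
    (innerSL ℝ φ).hasFDerivAt.comp x hΦ.hasFDerivAt
  rw [this.fderiv, hΦ.lineDeriv_eq_fderiv]
  rfl

section RKHS

variable {d : ℕ} {S : Set (Euc d)} {H : Type*} [NormedAddCommGroup H] [InnerProductSpace ℝ H]
  [CompleteSpace H] [RKHS ℝ H S ℝ]

/-- The canonical feature map of the space `H`, extended by zero. -/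
noncomputable def featureMap (S : Set (Euc d)) (H : Type*) [NormedAddCommGroup H]
    [InnerProductSpace ℝ H] [CompleteSpace H] [RKHS ℝ H S ℝ] (x : Euc d) : H :=
  if h : x ∈ S then RKHS.kerFun H (⟨x, h⟩ : S) (1 : ℝ) else 0

theorem inner_featureMap (φ : H) (x : Euc d) :
    inner ℝ φ (featureMap S H x) = zeroExt (φ : S → ℝ) x := by
  by_cases hx : x ∈ S
  · simp [featureMap, zeroExt, hx]
  · simp [featureMap, zeroExt, hx]

theorem ker_eq_inner (x y : Euc d) :
    ker S H x y = inner ℝ (featureMap S H x) (featureMap S H y) := by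
  by_cases hx : x ∈ S
  · by_cases hy : y ∈ S
    · simp only [ker, zeroExt, hx, hy, dif_pos, featureMap]
      have := RKHS.kernel_inner (𝕜 := ℝ) H (⟨x, hx⟩ : S) ⟨y, hy⟩ (1 : ℝ) (1 : ℝ)
      rw [real_inner_comm]
      rw [← this]
      simp
    · simp [ker, zeroExt, hx, hy, featureMap]
  · simp [ker, zeroExt, hx, featureMap]

theorem bddContDiffOn_iterPartial_featureMap (hS : UniqueDiffOn ℝ S) (hSc : IsCompact S) {n : ℕ}
    (hk : IsC2 n S (ker S H)) {j : ℕ} {ws : List (Fin d)} (h : ws.length + j ≤ n) :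
    BddContDiffOn j (iterPartial (featureMap S H) ws) (interior S) :=
  (hk.mixedDerivFamily hS hSc).bddContDiffOn_iterPartial isOpen_interior
    (fun x _ y _ => by simp [mixedDeriv, ker_eq_inner]) j ws h

/-- The feature map of the kernel `k_0`, one component for each coordinate. -/
noncomputable def steinFeature (S : Set (Euc d)) (H : Type*) [NormedAddCommGroup H]
    [InnerProductSpace ℝ H] [CompleteSpace H] [RKHS ℝ H S ℝ] (p : Euc d → ℝ) (i : Fin d) (x : Euc d) : H :=
  lineDeriv ℝ (featureMap S H) x (EuclideanSpace.single i 1) + score S p i x • featureMap S H x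

theorem contDiffOn_score (hS : UniqueDiffOn ℝ S) {p : Euc d → ℝ} {a : ℕ}
    (hp : ContDiffOn ℝ ((a + 1 : ℕ) : WithTop ℕ∞) p S) (hpos : ∀ x ∈ S, 0 < p x) (i : Fin d) :
    ContDiffOn ℝ a (score S p i) S := by
  have h1 : ContDiffOn ℝ ((a + 1 : ℕ) : WithTop ℕ∞) (fun y => Real.log (p y)) S :=
    hp.log fun x hx => (hpos x hx).ne'
  exact (h1.fderivWithin hS (m := a) (by simp)).clm_apply contDiffOn_const

/-- One derivative is spent on the feature map, leaving b, and one on log p, leaving a. -/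
theorem bddContDiffOn_steinFeature (hS : UniqueDiffOn ℝ S) (hSc : IsCompact S) {p : Euc d → ℝ}
    {a b : ℕ} (hp : ContDiffOn ℝ ((a + 1 : ℕ) : WithTop ℕ∞) p S) (hpos : ∀ x ∈ S, 0 < p x)
    (hk : IsC2 (b + 1) S (ker S H)) (i : Fin d) :
    BddContDiffOn (min a b) (steinFeature S H p i) (interior S) := by
  have hU : UniqueDiffOn ℝ (interior S) := isOpen_interior.uniqueDiffOn
  have h1 : BddContDiffOn b (iterPartial (featureMap S H) [i]) (interior S) :=
    bddContDiffOn_iterPartial_featureMap hS hSc hk (by simp; omega)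
  have h2 : BddContDiffOn b (iterPartial (featureMap S H) []) (interior S) :=
    bddContDiffOn_iterPartial_featureMap hS hSc hk (by simp)
  have h3 := BddContDiffOn.of_isCompact hSc hS (contDiffOn_score hS hp hpos i)
  exact (h1.of_le (min_le_right _ _)).add hU
    ((h3.of_le (min_le_left _ _)).smul hU (h2.of_le (min_le_right _ _)))

theorem differentiableAt_featureMap (hS : UniqueDiffOn ℝ S) (hSc : IsCompact S) {b : ℕ}
    (hk : IsC2 (b + 1) S (ker S H)) {x : Euc d} (hx : x ∈ interior S) :
    DifferentiableAt ℝ (featureMap S H) x := by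
  have h : BddContDiffOn (b + 1) (iterPartial (featureMap S H) []) (interior S) :=
    bddContDiffOn_iterPartial_featureMap hS hSc hk (by simp)
  exact (h.contDiffOn.contDiffAt (isOpen_interior.mem_nhds hx)).differentiableAt (by simp)

/-- At interior points derivatives of k pass through the inner product to the feature map; the four
terms of k_0 are then the four products of a binomial. -/
theorem kZero_eq_sum_inner (hS : UniqueDiffOn ℝ S) (hSc : IsCompact S) {b : ℕ}
    (hk : IsC2 (b + 1) S (ker S H)) (p : Euc d → ℝ) {x y : Euc d} (hx : x ∈ interior S)
    (hy : y ∈ interior S) :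
    kZero S p (ker S H) x y = ∑ i, inner ℝ (steinFeature S H p i x) (steinFeature S H p i y) := by
  refine Finset.sum_congr rfl fun i _ => ?_
  have hdx := differentiableAt_featureMap hS hSc hk hx
  have hdy := differentiableAt_featureMap hS hSc hk hy
  have e₁ : (fun u => pderiv S i (fun v => inner ℝ (featureMap S H u) (featureMap S H v)) y)
      = fun u => inner ℝ (lineDeriv ℝ (featureMap S H) y (EuclideanSpace.single i 1))
        (featureMap S H u) := funext fun u => by rw [pderiv_inner hy hdy, real_inner_comm]
  have e₂ : (fun u => inner ℝ (featureMap S H u) (featureMap S H y))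
      = fun u => inner ℝ (featureMap S H y) (featureMap S H u) :=
    funext fun u => real_inner_comm _ _
  simp only [ker_eq_inner]
  rw [e₁, e₂, pderiv_inner hy hdy, pderiv_inner hx hdx, pderiv_inner hx hdx]
  simp only [steinFeature, inner_add_left, inner_add_right, real_inner_smul_left,
    real_inner_smul_right]
  rw [real_inner_comm (lineDeriv ℝ (featureMap S H) x (EuclideanSpace.single i 1))
    (lineDeriv ℝ (featureMap S H) y (EuclideanSpace.single i 1)),
    real_inner_comm (lineDeriv ℝ (featureMap S H) x (EuclideanSpace.single i 1))
    (featureMap S H y)]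
  ring

theorem steinOp_eq_sum_inner (hS : UniqueDiffOn ℝ S) (hSc : IsCompact S) {b : ℕ}
    (hk : IsC2 (b + 1) S (ker S H)) (p : Euc d → ℝ) (φ : Fin d → H) {x : Euc d}
    (hx : x ∈ interior S) :
    steinOp S p (fun i => zeroExt (φ i)) x = ∑ i, inner ℝ (φ i) (steinFeature S H p i x) := by
  refine Finset.sum_congr rfl fun i _ => ?_
  have hz : (zeroExt (φ i : S → ℝ)) = fun x => inner ℝ (φ i) (featureMap S H x) :=
    funext fun x => (inner_featureMap _ _).symm
  simp only [hz, pderiv_inner hx (differentiableAt_featureMap hS hSc hk hx), steinFeature,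
    inner_add_right, real_inner_smul_right]
  ring

end RKHS

/-! ### Kernel interpolation as orthogonal projection -/

/-- On `U`, the kernel `K` has the bounded continuous feature map `Φ`, and `f` is represented by
the vector `F`. -/
structure FeatureRep {d : ℕ} {G : Type*} [NormedAddCommGroup G] [InnerProductSpace ℝ G]
    (U : Set (Euc d)) (K : Euc d → Euc d → ℝ) (f : Euc d → ℝ) (Φ : Euc d → G) (F : G) (B : ℝ) :
    Prop where
  cont : ContinuousOn Φ U
  bdd : ∀ x ∈ U, ‖Φ x‖ ≤ B
  kernel : ∀ x ∈ U, ∀ y ∈ U, K x y = inner ℝ (Φ x) (Φ y)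
  eq : ∀ x ∈ U, f x = inner ℝ F (Φ x)

namespace FeatureRep

variable {d : ℕ} {G : Type*} [NormedAddCommGroup G] [InnerProductSpace ℝ G]
  {U : Set (Euc d)} {K : Euc d → Euc d → ℝ} {f : Euc d → ℝ} {Φ : Euc d → G} {F : G} {B : ℝ}
  {m : ℕ} {D₀ : Fin m → Euc d}

/-- The interpolation equations say that F - E is orthogonal to every Φ(D₀ j). As E lies in their
span, it is the projection of F, and Pythagoras gives both norm bounds. -/
theorem exists_interpolant_eq (h : FeatureRep U K f Φ F B) (hD : ∀ i, D₀ i ∈ U)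
    (hdet : IsUnit (gram K D₀).det) :
    ∃ E : G, (∀ x ∈ U, interpolant K f D₀ x = inner ℝ E (Φ x)) ∧
      (∀ j, inner ℝ (F - E) (Φ (D₀ j)) = 0) ∧ ‖F - E‖ ≤ ‖F‖ ∧ ‖E‖ ≤ ‖F‖ := by
  set α := (gram K D₀)⁻¹ *ᵥ fun j => f (D₀ j) with hα
  set E : G := ∑ i, α i • Φ (D₀ i) with hE
  have horth : ∀ j, inner ℝ (F - E) (Φ (D₀ j)) = 0 := by
    intro j
    have h1 : (gram K D₀ *ᵥ α) j = f (D₀ j) := by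
      rw [hα, Matrix.mulVec_mulVec, Matrix.mul_nonsing_inv _ hdet, Matrix.one_mulVec]
    rw [inner_sub_left, ← h.eq _ (hD j), ← h1, hE, sum_inner, sub_eq_zero]
    simp only [Matrix.mulVec, dotProduct, gram, Matrix.of_apply, real_inner_smul_left]
    refine Finset.sum_congr rfl fun i _ => ?_
    rw [h.kernel _ (hD j) _ (hD i), real_inner_comm, mul_comm]
  have hpyth : inner ℝ (F - E) E = 0 := by
    conv_lhs => rw [hE]
    rw [inner_sum]
    exact Finset.sum_eq_zero fun i _ => by rw [real_inner_smul_right, horth i, mul_zero]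
  have hsq : ‖F‖ * ‖F‖ = ‖F - E‖ * ‖F - E‖ + ‖E‖ * ‖E‖ := by
    rw [← norm_add_sq_eq_norm_sq_add_norm_sq_of_inner_eq_zero _ _ hpyth, sub_add_cancel]
  refine ⟨E, fun x hx => ?_, horth, ?_, ?_⟩
  · rw [interpolant, if_pos hdet, hE, sum_inner]
    refine Finset.sum_congr rfl fun i _ => ?_
    rw [real_inner_smul_left, h.kernel _ hx _ (hD i), real_inner_comm]
  · exact abs_le_of_sq_le_sq' (by nlinarith [mul_self_nonneg ‖E‖]) (norm_nonneg _) |>.2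
  · exact abs_le_of_sq_le_sq' (by nlinarith [mul_self_nonneg ‖F - E‖]) (norm_nonneg _) |>.2

theorem abs_interpolant_le (h : FeatureRep U K f Φ F B) (hD : ∀ i, D₀ i ∈ U) {x : Euc d}
    (hx : x ∈ U) : |interpolant K f D₀ x| ≤ ‖F‖ * B := by
  have hB : 0 ≤ B := (norm_nonneg _).trans (h.bdd x hx)
  by_cases hdet : IsUnit (gram K D₀).det
  · obtain ⟨E, hE, -, -, hn⟩ := h.exists_interpolant_eq hD hdet
    rw [hE x hx]
    exact (abs_real_inner_le_norm _ _).trans (mul_le_mul hn (h.bdd x hx) (norm_nonneg _)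
      (norm_nonneg _))
  · rw [interpolant, if_neg hdet, abs_zero]
    positivity

/-- Any combination of the Φ(D₀ j) may be subtracted from Φ(x) at no cost, since F - E is orthogonal
to it. -/
theorem abs_sub_interpolant_le (h : FeatureRep U K f Φ F B) (hD : ∀ i, D₀ i ∈ U)
    (hdet : IsUnit (gram K D₀).det) {ι : Type*} [Fintype ι] (u : ι → ℝ) (σ : ι → Fin m)
    {x : Euc d} (hx : x ∈ U) :
    |f x - interpolant K f D₀ x| ≤ ‖F‖ * ‖Φ x - ∑ j, u j • Φ (D₀ (σ j))‖ := by
  obtain ⟨E, hE, horth, hn, -⟩ := h.exists_interpolant_eq hD hdet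
  have : f x - interpolant K f D₀ x = inner ℝ (F - E) (Φ x - ∑ j, u j • Φ (D₀ (σ j))) := by
    rw [inner_sub_right, inner_sum, Finset.sum_eq_zero, sub_zero, inner_sub_left, h.eq x hx,
      hE x hx]
    intro j _
    rw [real_inner_smul_right, horth, mul_zero]
  rw [this]
  exact (abs_real_inner_le_norm _ _).trans (by gcongr)

end FeatureRep

/-! ### Feature space of the kernel k_+ -/

section PlusFeature

variable {d : ℕ} {S : Set (Euc d)} {H : Type*} [NormedAddCommGroup H] [InnerProductSpace ℝ H]

/-- The feature space of the kernel `k_+`. -/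
abbrev PlusSpace (d : ℕ) (H : Type*) [NormedAddCommGroup H] [InnerProductSpace ℝ H] : Type _ :=
  WithLp 2 (ℝ × PiLp 2 (fun _ : Fin d => H))

/-- The vector of the feature space with components `t` and `φ`. -/
def plusVec {d : ℕ} {H : Type*} [NormedAddCommGroup H] [InnerProductSpace ℝ H] (t : ℝ)
    (φ : Fin d → H) : PlusSpace d H := WithLp.toLp 2 (t, WithLp.toLp 2 φ)

theorem inner_plusVec (t t' : ℝ) (φ φ' : Fin d → H) :
    inner ℝ (plusVec t φ) (plusVec t' φ') = t * t' + ∑ i, inner ℝ (φ i) (φ' i) := by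
  simp [plusVec, WithLp.prod_inner_apply, PiLp.inner_apply, mul_comm]

theorem BddContDiffOn.plusVec {U : Set (Euc d)} (hU : UniqueDiffOn ℝ U) {s : ℕ} (t : ℝ)
    {Ψ : Fin d → Euc d → H} (h : ∀ i, BddContDiffOn s (Ψ i) U) :
    BddContDiffOn s (fun x => plusVec t (fun i => Ψ i x)) U := by
  let L : Fin d → H →L[ℝ] PlusSpace d H := fun i =>
    ((WithLp.prodContinuousLinearEquiv 2 ℝ ℝ (PiLp 2 (fun _ : Fin d => H))).symm :
      _ →L[ℝ] PlusSpace d H) ∘L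
    (ContinuousLinearMap.inr ℝ ℝ (PiLp 2 (fun _ : Fin d => H))) ∘L
    ((PiLp.continuousLinearEquiv 2 ℝ (fun _ : Fin d => H)).symm : _ →L[ℝ] _) ∘L
    (ContinuousLinearMap.single ℝ (fun _ : Fin d => H) i)
  refine ((BddContDiffOn.const (SteinCF.plusVec t 0)).add hU
    (BddContDiffOn.sum hU Finset.univ fun i _ => (h i).clm_comp hU (L i))).congr fun x _ => ?_
  have hL : ∀ i h, L i h = SteinCF.plusVec 0 (Pi.single i h) := fun i h => rfl
  simp only [hL, SteinCF.plusVec]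
  apply WithLp.ofLp_injective
  refine Prod.ext ?_ ?_
  · simp [WithLp.ofLp_sum, Prod.fst_sum]
  · simp only [WithLp.ofLp_add, WithLp.ofLp_sum, Prod.snd_add, Prod.snd_sum]
    ext i
    simp

theorem exists_featureRep [CompleteSpace H] [RKHS ℝ H S ℝ] (hS : UniqueDiffOn ℝ S) (hSc : IsCompact S) {p : Euc d → ℝ}
    {a b : ℕ} {c : ℝ} (hc : 0 < c) (hp : ContDiffOn ℝ ((a + 1 : ℕ) : WithTop ℕ∞) p S)
    (hpos : ∀ x ∈ S, 0 < p x) (hk : IsC2 (b + 1) S (ker S H)) {f : Euc d → ℝ}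
    (hf : MemHPlus S p H f) :
    ∃ (Φ : Euc d → PlusSpace d H) (F : PlusSpace d H) (B : ℝ),
      BddContDiffOn (min a b) Φ (interior S) ∧
        FeatureRep (interior S) (kPlus S p (ker S H) c) f Φ F B := by
  obtain ⟨β, φ, hf⟩ := hf
  have hΦ : BddContDiffOn (min a b)
      (fun x => SteinCF.plusVec (√c) (fun i => steinFeature S H p i x)) (interior S) :=
    BddContDiffOn.plusVec isOpen_interior.uniqueDiffOn _ fun i =>
      bddContDiffOn_steinFeature hS hSc hp hpos hk i
  obtain ⟨B, hB⟩ := hΦ.exists_bound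
  -- The component √c of Φ contributes √c · √c = c to the kernel; paired with it, β / √c gives β.
  refine ⟨_, SteinCF.plusVec (β / √c) φ, B, hΦ, hΦ.contDiffOn.continuousOn, hB,
    fun x hx y hy => ?_, fun x hx => ?_⟩
  · rw [inner_plusVec, Real.mul_self_sqrt hc.le, kPlus, kZero_eq_sum_inner hS hSc hk p hx hy]
  · rw [inner_plusVec, div_mul_cancel₀ _ (Real.sqrt_pos.2 hc).ne', hf x (interior_subset hx),
      steinOp_eq_sum_inner hS hSc hk p φ hx]

end PlusFeature

/-! ### Local designs and the deterministic interpolation error -/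

/-- Reference points `y₀` for polynomial reproduction at `x`, with tolerance `δ`: balls of radius
`δ` at them, scaled by a factor at most `r` and moved to `x`, lie in `S`, and points in these balls
admit reproducing weights of sum at most `C`. -/
structure IsLocalDesign {d s : ℕ} (S : Set (Euc d)) (r δ C : ℝ) (x : Euc d)
    (y₀ : (Fin d → Fin s) → Euc d) : Prop where
  norm_le : ∀ j, ∀ v ∈ ball (y₀ j) δ, ‖v‖ ≤ 1
  mem : ∀ j, ∀ v ∈ ball (y₀ j) δ, ∀ t ∈ Icc 0 r, x + t • v ∈ S
  weights : ∀ y : (Fin d → Fin s) → Euc d, (∀ j, y j ∈ ball (y₀ j) δ) →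
    ∃ u : (Fin d → Fin s) → ℝ, ∑ j, |u j| ≤ C ∧ Reproduces u y

/-- The centres ξ/2 lie on a compact sphere, whence constants uniform in x. In the minimum, ρ keeps
the points in the cone and 1/2 keeps their norms at most 1. -/
theorem HasConeBalls.exists_isLocalDesign {d : ℕ} (s : ℕ) {S : Set (Euc d)} {ρ r : ℝ}
    (hρ : 0 < ρ) (h : HasConeBalls S ρ r) :
    ∃ δ > 0, ∃ C : ℝ, ∀ x ∈ S, ∃ y₀ : (Fin d → Fin s) → Euc d, IsLocalDesign S r δ C x y₀ := by
  obtain ⟨δ, hδ, C, hC⟩ := exists_stable_reproduction s (isCompact_sphere (0 : Euc d) (1 / 2))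
    (show 0 < min ρ (1 / 2) by positivity)
  refine ⟨δ, hδ, C, fun x hx => ?_⟩
  obtain ⟨ξ, hξ, hS⟩ := h x hx
  obtain ⟨y₀, hy₀, hu⟩ := hC ((1 / 2 : ℝ) • ξ) (by simp [norm_smul, hξ])
  refine ⟨y₀, fun j v hv => ?_, fun j v hv => hS v ?_, hu⟩
  · have h1 := (mem_ball.1 (hy₀ j hv)).trans_le (min_le_right _ _)
    rw [dist_eq_norm] at h1
    calc ‖v‖ = ‖(v - (1 / 2 : ℝ) • ξ) + (1 / 2 : ℝ) • ξ‖ := by simp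
      _ ≤ 1 / 2 + 1 / 2 := (norm_add_le _ _).trans (add_le_add h1.le (by simp [norm_smul, hξ]))
      _ = 1 := by norm_num
  · exact closedBall_subset_closedBall (min_le_left _ _) (ball_subset_closedBall (hy₀ j hv))

namespace IsLocalDesign

variable {d s : ℕ} {S : Set (Euc d)} {r δ C : ℝ} {x : Euc d} {y₀ : (Fin d → Fin s) → Euc d}

theorem ball_subset (h : IsLocalDesign S r δ C x y₀) {R : ℝ} (hR : 0 < R) (hRr : R ≤ r)
    (j : Fin d → Fin s) : ball (x + R • y₀ j) (R * δ) ⊆ interior S := by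
  refine interior_maximal ?_ isOpen_ball
  rw [ball_add_smul _ _ hR]
  rintro _ ⟨v, hv, rfl⟩
  exact h.mem j v hv R ⟨hR.le, hRr⟩

theorem add_smul_mem_interior (h : IsLocalDesign S r δ C x y₀) {R : ℝ} (hR : 0 < R) (hRr : R ≤ r)
    (j : Fin d → Fin s) {v : Euc d} (hv : v ∈ ball (y₀ j) δ) : x + R • v ∈ interior S := by
  refine h.ball_subset hR hRr j ?_
  rw [ball_add_smul _ _ hR]
  exact ⟨v, hv, rfl⟩

/-- The interpolation error is of order `R ^ s` where there are data points at each reference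
point, at scale `R`. -/
theorem abs_sub_interpolant_le (h : IsLocalDesign S r δ C x y₀) {G : Type*} [NormedAddCommGroup G]
    [InnerProductSpace ℝ G] {K : Euc d → Euc d → ℝ} {f : Euc d → ℝ} {Φ : Euc d → G} {F : G}
    {B M : ℝ} (hrep : FeatureRep (interior S) K f Φ F B) (hΦ : ContDiffOn ℝ s Φ (interior S))
    (hM : ∀ x ∈ interior S, ‖iteratedFDerivWithin ℝ s Φ (interior S) x‖ ≤ M)
    (hx : x ∈ interior S) {R : ℝ} (hR : 0 < R) (hRr : R ≤ r) {m : ℕ} {D₀ : Fin m → Euc d}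
    (hD : ∀ i, D₀ i ∈ interior S) (hdet : IsUnit (gram K D₀).det)
    (hnear : ∀ j, ∃ i, D₀ i ∈ ball (x + R • y₀ j) (R * δ)) :
    |f x - interpolant K f D₀ x| ≤ ‖F‖ * ((1 + C) * M * R ^ s) := by
  choose σ hσ using hnear
  have : ∀ j, ∃ v ∈ ball (y₀ j) δ, x + R • v = D₀ (σ j) := fun j => by
    have := hσ j
    rwa [ball_add_smul _ _ hR] at this
  choose y hy hyD using this
  obtain ⟨u, hu, hrepr⟩ := h.weights y hy
  refine (hrep.abs_sub_interpolant_le hD hdet u σ hx).trans ?_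
  gcongr
  simp only [← hyD]
  refine hrepr.norm_sub_sum_le isOpen_interior hΦ hM hu hR.le (fun j => h.norm_le j _ (hy j)) hx
    fun j t ht => ?_
  -- At t = 0 the point is x; for t > 0 it belongs to the design at the smaller scale t R.
  rcases ht.1.eq_or_lt with rfl | ht0
  · simpa using hx
  · rw [smul_smul]
    exact h.add_smul_mem_interior (by positivity)
      ((mul_le_of_le_one_left hR.le ht.2).trans hRr) j (hy j)

end IsLocalDesign

/-! ### Random designs: pointwise mean square error and choice of scale -/

theorem law_compl {d : ℕ} {S : Set (Euc d)} (hS : MeasurableSet S) (q : Euc d → ℝ) :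
    law S q Sᶜ = 0 := by
  refine (withDensity_absolutelyContinuous _ _) ?_
  rw [Measure.restrict_apply hS.compl]
  simp

theorem law_compl_of_null {d : ℕ} {S U : Set (Euc d)} (hS : MeasurableSet S)
    (h : volume (S \ U) = 0) (q : Euc d → ℝ) : law S q Uᶜ = 0 := by
  refine (withDensity_absolutelyContinuous _ _) ?_
  rw [Measure.restrict_apply' hS, ← sdiff_eq_compl_inter]
  exact h

theorem le_law_ball {d : ℕ} {S : Set (Euc d)} {q : Euc d → ℝ} {ε : ℝ}
    (hq : ∀ x ∈ S, ε ≤ q x) {z : Euc d} {R δ : ℝ} (hR : 0 < R) (hsub : ball z (R * δ) ⊆ S)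
    [IsFiniteMeasure (law S q)] :
    ε * (volume (ball (0 : Euc d) δ)).toReal * R ^ d ≤ (law S q).real (ball z (R * δ)) := by
  rcases le_or_gt ε 0 with hε | hε
  · refine le_trans ?_ measureReal_nonneg
    exact mul_nonpos_of_nonpos_of_nonneg (mul_nonpos_of_nonpos_of_nonneg hε ENNReal.toReal_nonneg)
      (by positivity)
  have h1 : ENNReal.ofReal ε * volume (ball z (R * δ)) ≤ law S q (ball z (R * δ)) := by
    rw [law, withDensity_apply _ measurableSet_ball, Measure.restrict_restrict measurableSet_ball,
      inter_eq_self_of_subset_left hsub, ← setLIntegral_const]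
    exact setLIntegral_mono' measurableSet_ball fun x hx => ENNReal.ofReal_le_ofReal (hq x (hsub hx))
  rw [Measure.addHaar_ball_mul_of_pos _ _ hR] at h1
  have h2 := ENNReal.toReal_mono (measure_ne_top _ _) h1
  rw [ENNReal.toReal_mul, ENNReal.toReal_mul, ENNReal.toReal_ofReal hε.le,
    ENNReal.toReal_ofReal (by positivity), finrank_euclideanSpace, Fintype.card_fin] at h2
  calc _ = _ := by ring
    _ ≤ _ := h2

/-- The probability that none of `m` independent draws hits a set. -/
theorem iidLaw_forall_notMem_le {d : ℕ} (P : Measure (Euc d)) [IsProbabilityMeasure P] (m : ℕ)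
    {A : Set (Euc d)} (hA : MeasurableSet A) {q : ℝ} (hq : q ≤ P.real A) :
    (iidLaw P m).real {D₀ | ∀ i, D₀ i ∉ A} ≤ Real.exp (-(m * q)) := by
  have : {D₀ : Fin m → Euc d | ∀ i, D₀ i ∉ A} = Set.pi univ fun _ => Aᶜ := by
    ext; simp
  rw [this, iidLaw, measureReal_def, Measure.pi_pi, Finset.prod_const, Finset.card_univ,
    Fintype.card_fin, ENNReal.toReal_pow, ← measureReal_def, probReal_compl_eq_one_sub hA]
  calc (1 - P.real A) ^ m ≤ Real.exp (-q) ^ m := by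
        gcongr
        · linarith [measureReal_le_one (μ := P) (s := A)]
        · linarith [Real.add_one_le_exp (-q)]
    _ = _ := by rw [← Real.exp_nat_mul]; ring_nf

theorem ae_iidLaw_forall_mem {d : ℕ} (P : Measure (Euc d)) [IsProbabilityMeasure P] (m : ℕ)
    {U : Set (Euc d)} (hU : P Uᶜ = 0) : ∀ᵐ D₀ ∂(iidLaw P m), ∀ i, D₀ i ∈ U := by
  refine eventually_all.2 fun i => ?_
  exact (measurePreserving_eval (fun _ : Fin m => P) i).quasiMeasurePreserving.ae
    (show ∀ᵐ x ∂P, x ∈ U from hU)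

/-- If every reference ball contains a data point, the deterministic O(R^s) bound holds. The
complementary event is handled by a union bound and the crude estimate ‖F‖ B. -/
theorem IsLocalDesign.integral_sq_sub_interpolant_le {d s : ℕ} {S : Set (Euc d)} {r δ C : ℝ}
    {x : Euc d} {y₀ : (Fin d → Fin s) → Euc d} (h : IsLocalDesign S r δ C x y₀) {G : Type*}
    [NormedAddCommGroup G] [InnerProductSpace ℝ G] {K : Euc d → Euc d → ℝ} {f : Euc d → ℝ}
    {Φ : Euc d → G} {F : G} {B M : ℝ} (hrep : FeatureRep (interior S) K f Φ F B)
    (hΦ : ContDiffOn ℝ s Φ (interior S))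
    (hM : ∀ x ∈ interior S, ‖iteratedFDerivWithin ℝ s Φ (interior S) x‖ ≤ M)
    (hx : x ∈ interior S) {R : ℝ} (hR : 0 < R) (hRr : R ≤ r) (P : Measure (Euc d))
    [IsProbabilityMeasure P] (hP : P (interior S)ᶜ = 0) {m : ℕ}
    (hdet : ∀ᵐ D₀ ∂(iidLaw P m), IsUnit (gram K D₀).det) {q : ℝ}
    (hq : ∀ j, q ≤ P.real (ball (x + R • y₀ j) (R * δ))) :
    ∫ D₀, (f x - interpolant K f D₀ x) ^ 2 ∂(iidLaw P m)
      ≤ (‖F‖ * ((1 + C) * M)) ^ 2 * R ^ (2 * s)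
        + (‖F‖ * B) ^ 2 * Fintype.card (Fin d → Fin s) * Real.exp (-(m * q)) := by
  have : IsProbabilityMeasure (iidLaw P m) := by unfold iidLaw; infer_instance
  set bad : (Fin d → Fin s) → Set (Fin m → Euc d) :=
    fun j => {D₀ | ∀ i, D₀ i ∉ ball (x + R • y₀ j) (R * δ)} with hbad
  have hbadm : ∀ j, MeasurableSet (bad j) := fun j => by
    have : bad j = ⋂ i, (fun D₀ : Fin m → Euc d => D₀ i) ⁻¹' (ball (x + R • y₀ j) (R * δ))ᶜ := by
      ext; simp [hbad]
    rw [this]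
    exact MeasurableSet.iInter fun i => measurable_pi_apply i measurableSet_ball.compl
  set A := (‖F‖ * ((1 + C) * M)) ^ 2 * R ^ (2 * s)
  have hint : ∀ j, Integrable ((bad j).indicator fun _ => (‖F‖ * B) ^ 2) (iidLaw P m) :=
    fun j => (integrable_const _).indicator (hbadm j)
  have hA0 : 0 ≤ A := by positivity
  have hle : ∀ᵐ D₀ ∂(iidLaw P m), (f x - interpolant K f D₀ x) ^ 2
      ≤ A + ∑ j, (bad j).indicator (fun _ => (‖F‖ * B) ^ 2) D₀ := by
    filter_upwards [hdet, ae_iidLaw_forall_mem P m hP] with D₀ hdet hD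
    have hnn : ∀ j, 0 ≤ (bad j).indicator (fun _ => (‖F‖ * B) ^ 2) D₀ := fun j =>
      indicator_nonneg (fun _ _ => by positivity) _
    by_cases hb : ∃ j, D₀ ∈ bad j
    · obtain ⟨j, hj⟩ := hb
      -- With no weights at all, the error bound is ‖F‖ ‖Φ(x)‖.
      have h1 := hrep.abs_sub_interpolant_le hD hdet (ι := Fin 0) 0 (fun i => i.elim0) hx
      have h2 : |f x - interpolant K f D₀ x| ≤ ‖F‖ * B := by
        refine h1.trans ?_
        gcongr
        simpa using hrep.bdd x hx
      calc (f x - interpolant K f D₀ x) ^ 2 = |f x - interpolant K f D₀ x| ^ 2 := (sq_abs _).symm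
        _ ≤ (‖F‖ * B) ^ 2 := by gcongr
        _ = (bad j).indicator (fun _ => (‖F‖ * B) ^ 2) D₀ := by rw [indicator_of_mem hj]
        _ ≤ ∑ j, (bad j).indicator (fun _ => (‖F‖ * B) ^ 2) D₀ :=
          Finset.single_le_sum (fun j _ => hnn j) (Finset.mem_univ j)
        _ ≤ _ := le_add_of_nonneg_left hA0
    · have hnear : ∀ j, ∃ i, D₀ i ∈ ball (x + R • y₀ j) (R * δ) := fun j => by
        by_contra hno
        exact hb ⟨j, fun i hi => hno ⟨i, hi⟩⟩
      have h1 := h.abs_sub_interpolant_le hrep hΦ hM hx hR hRr hD hdet hnear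
      calc (f x - interpolant K f D₀ x) ^ 2 = |f x - interpolant K f D₀ x| ^ 2 := (sq_abs _).symm
        _ ≤ (‖F‖ * ((1 + C) * M * R ^ s)) ^ 2 := by gcongr
        _ = A := by simp only [A]; ring
        _ ≤ _ := le_add_of_nonneg_right (Finset.sum_nonneg fun j _ => hnn j)
  calc _ ≤ ∫ D₀, (A + ∑ j, (bad j).indicator (fun _ => (‖F‖ * B) ^ 2) D₀) ∂(iidLaw P m) :=
        integral_mono_of_nonneg (ae_of_all _ fun _ => sq_nonneg _)
          ((integrable_const _).add (integrable_finsetSum _ fun j _ => hint j)) hle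
    _ = A + ∑ j, (iidLaw P m).real (bad j) * (‖F‖ * B) ^ 2 := by
        rw [integral_add (integrable_const _) (integrable_finsetSum _ fun j _ => hint j),
          integral_finsetSum _ fun j _ => hint j]
        simp only [integral_const, probReal_univ, integral_indicator_const _ (hbadm _),
          smul_eq_mul, one_mul]
    _ ≤ A + ∑ _j : Fin d → Fin s, Real.exp (-(m * q)) * (‖F‖ * B) ^ 2 := by
        gcongr with j
        exact iidLaw_forall_notMem_le P m measurableSet_ball (hq j)
    _ = _ := by
        rw [Finset.sum_const, Finset.card_univ, nsmul_eq_mul]; ring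

/-- Take R = r m^(-1/d + η). Then R^(2s) loses only a factor m^(2sη) ≤ m^ε, while m R^d = r^d m^(dη)
grows, so the exponential decays faster than any power of m. -/
theorem exists_rate {d : ℕ} (hd : 0 < d) (s : ℕ) {r q C₁ C₂ : ℝ} (hr : 0 < r) (hq : 0 < q)
    (h1 : 0 ≤ C₁) (h2 : 0 ≤ C₂) {ε : ℝ} (hε : 0 < ε) :
    ∃ C : ℝ, ∀ m : ℕ, 1 ≤ m → ∃ R, 0 < R ∧ R ≤ r ∧
      C₁ * R ^ (2 * s) + C₂ * Real.exp (-(m * (q * R ^ d)))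
        ≤ C * (m : ℝ) ^ (-2 * (s : ℝ) / d + ε) := by
  have hd' : (0 : ℝ) < d := by exact_mod_cast hd
  -- The first bound ensures R ≤ r, the second 2sη ≤ ε; the summand 1 covers s = 0.
  set η : ℝ := min (1 / d) (ε / (2 * s + 1)) with hη
  have hη0 : 0 < η := by positivity
  have hη1 : η ≤ 1 / d := min_le_left _ _
  have hη2 : 2 * s * η ≤ ε := by
    have : η ≤ ε / (2 * s + 1) := min_le_right _ _
    rw [le_div_iff₀ (by positivity)] at this
    nlinarith
  -- The power k in exp(-t) ≤ k!/t^k is large enough for m^(-dηk) ≤ m^(-2s/d).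
  obtain ⟨k, hk⟩ := exists_nat_ge (2 * (s : ℝ) / d / (d * η))
  have hk' : 2 * (s : ℝ) / d ≤ d * η * k := by
    rw [div_le_iff₀ (by positivity)] at hk; linarith
  refine ⟨C₁ * r ^ (2 * s) + C₂ * (k.factorial / (q * r ^ d) ^ k), fun m hm => ?_⟩
  have hm1 : (1 : ℝ) ≤ m := by exact_mod_cast hm
  have hm0 : (0 : ℝ) < m := by linarith
  refine ⟨r * (m : ℝ) ^ (-(1 / d) + η), by positivity, mul_le_of_le_one_right hr.le
    (Real.rpow_le_one_of_one_le_of_nonpos hm1 (by linarith)), ?_⟩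
  rw [add_mul, mul_assoc C₁, mul_assoc C₂]
  gcongr
  · rw [mul_pow, ← Real.rpow_natCast ((m : ℝ) ^ _), ← Real.rpow_mul hm0.le]
    gcongr ?_ * ?_
    refine Real.rpow_le_rpow_of_exponent_le hm1 ?_
    push_cast
    have : (-(1 / (d : ℝ)) + η) * (2 * s) = -2 * s / d + 2 * s * η := by ring
    linarith
  · have hmR : (m : ℝ) * (q * (r * (m : ℝ) ^ (-(1 / (d : ℝ)) + η)) ^ d)
        = q * r ^ d * (m : ℝ) ^ (d * η) := by
      rw [mul_pow, ← Real.rpow_natCast ((m : ℝ) ^ _), ← Real.rpow_mul hm0.le]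
      have : (m : ℝ) ^ (d * η) = m * (m : ℝ) ^ ((-(1 / (d : ℝ)) + η) * d) := by
        rw [← Real.rpow_one_add' hm0.le]
        · congr 1; field_simp; ring
        · have : 1 + (-(1 / (d : ℝ)) + η) * d = d * η := by field_simp; ring
          rw [this]; positivity
      rw [this]; ring
    rw [hmR, Real.exp_neg]
    set t := q * r ^ d * (m : ℝ) ^ (d * η) with ht
    have ht0 : 0 < t := by positivity
    have h3 := Real.pow_div_factorial_le_exp t ht0.le k
    calc (Real.exp t)⁻¹ ≤ (t ^ k / k.factorial)⁻¹ := by gcongr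
      _ = k.factorial / (q * r ^ d) ^ k * (m : ℝ) ^ (-(d * η * k)) := by
        rw [inv_div, ht, mul_pow, ← Real.rpow_natCast ((m : ℝ) ^ _), ← Real.rpow_mul hm0.le,
          Real.rpow_neg hm0.le]
        field_simp
      _ ≤ _ := by
        gcongr ?_ * ?_
        refine Real.rpow_le_rpow_of_exponent_le hm1 ?_
        have : -2 * (s : ℝ) / d = -(2 * s / d) := by ring
        rw [this]
        linarith

/-! ### Measurability and integrability of the interpolant and the estimator -/

instance {d : ℕ} (P : Measure (Euc d)) [IsProbabilityMeasure P] (m : ℕ) :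
    IsProbabilityMeasure (iidLaw P m) := by unfold iidLaw; infer_instance

theorem iidLaw_measurePreserving_eval {d : ℕ} (P : Measure (Euc d)) [IsProbabilityMeasure P]
    {l : ℕ} (i : Fin l) : MeasurePreserving (fun D : Fin l → Euc d => D i) (iidLaw P l) P :=
  measurePreserving_eval (fun _ : Fin l => P) i

/-- The inverse matrix is the adjugate divided by the determinant, both continuous in the entries.
-/
theorem measurable_interpolant {d m : ℕ} {K : Euc d → Euc d → ℝ} {f : Euc d → ℝ}
    (hK : Measurable fun z : Euc d × Euc d => K z.1 z.2) (hf : Measurable f) :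
    Measurable fun z : (Fin m → Euc d) × Euc d => interpolant K f z.1 z.2 := by
  have hev : ∀ i, Measurable fun z : (Fin m → Euc d) × Euc d => z.1 i :=
    fun i => (measurable_pi_apply i).comp measurable_fst
  have hgram : Measurable fun z : (Fin m → Euc d) × Euc d => fun i j => K (z.1 i) (z.1 j) :=
    measurable_pi_lambda _ fun i => measurable_pi_lambda _ fun j =>
      hK.comp ((hev i).prodMk (hev j))
  have hdet : Measurable fun z : (Fin m → Euc d) × Euc d => (gram K z.1).det := by
    have : Continuous fun A : Fin m → Fin m → ℝ => (Matrix.of A).det :=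
      Continuous.matrix_det continuous_id
    exact this.measurable.comp hgram
  have hadj : ∀ i j, Measurable fun z : (Fin m → Euc d) × Euc d => (gram K z.1).adjugate i j := by
    intro i j
    have : Continuous fun A : Fin m → Fin m → ℝ => (Matrix.of A).adjugate i j :=
      (Continuous.matrix_adjugate continuous_id).matrix_elem i j
    exact this.measurable.comp hgram
  unfold interpolant
  refine Measurable.ite ?_ ?_ measurable_const
  · simp only [isUnit_iff_ne_zero]
    exact hdet (measurableSet_singleton 0).compl
  · refine Finset.measurable_sum _ fun i _ => Measurable.mul ?_ (hK.comp (measurable_snd.prodMk (hev i)))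
    simp only [Matrix.mulVec, dotProduct, Matrix.inv_def, Ring.inverse_eq_inv', Matrix.smul_apply,
      smul_eq_mul]
    exact Finset.measurable_sum _ fun j _ => (hdet.inv.mul (hadj i j)).mul (hf.comp (hev j))

theorem interpolant_congr {d m : ℕ} {U : Set (Euc d)} {K K' : Euc d → Euc d → ℝ}
    {f f' : Euc d → ℝ} (hK : ∀ x ∈ U, ∀ y ∈ U, K x y = K' x y) (hf : ∀ x ∈ U, f x = f' x)
    {D₀ : Fin m → Euc d} (hD : ∀ i, D₀ i ∈ U) {x : Euc d} (hx : x ∈ U) :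
    interpolant K f D₀ x = interpolant K' f' D₀ x := by
  have hg : gram K D₀ = gram K' D₀ := by
    ext i j; exact hK _ (hD i) _ (hD j)
  unfold interpolant
  rw [hg]
  simp only [hf _ (hD _), hK x hx _ (hD _)]

theorem ae_prod_forall_mem {d : ℕ} (P : Measure (Euc d)) [IsProbabilityMeasure P] (m : ℕ)
    {U : Set (Euc d)} (hU : P Uᶜ = 0) :
    ∀ᵐ z ∂((iidLaw P m).prod P), (∀ i, z.1 i ∈ U) ∧ z.2 ∈ U :=
  (Measure.quasiMeasurePreserving_fst.ae (ae_iidLaw_forall_mem P m hU)).and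
    (Measure.quasiMeasurePreserving_snd.ae (show ∀ᵐ x ∂P, x ∈ U from hU))

namespace FeatureRep

variable {d : ℕ} {G : Type*} [NormedAddCommGroup G] [InnerProductSpace ℝ G]
  {U : Set (Euc d)} {K : Euc d → Euc d → ℝ} {f : Euc d → ℝ} {Φ : Euc d → G} {F : G} {B : ℝ}
  {P : Measure (Euc d)} [IsProbabilityMeasure P]

/-- K and f are controlled only on U. Setting them to zero elsewhere makes them measurable and
changes the interpolant only on a null set. -/
theorem aestronglyMeasurable_interpolant (h : FeatureRep U K f Φ F B) (hU : IsOpen U)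
    (hP : P Uᶜ = 0) (m : ℕ) :
    AEStronglyMeasurable (fun z : (Fin m → Euc d) × Euc d => interpolant K f z.1 z.2)
      ((iidLaw P m).prod P) := by
  set K' : Euc d → Euc d → ℝ := fun x y =>
    (U ×ˢ U).indicator (fun z : Euc d × Euc d => inner ℝ (Φ z.1) (Φ z.2)) (x, y)
  set f' : Euc d → ℝ := U.indicator fun x => inner ℝ F (Φ x)
  have hK' : Measurable fun z : Euc d × Euc d => K' z.1 z.2 := by
    have hc : ContinuousOn (fun z : Euc d × Euc d => inner ℝ (Φ z.1) (Φ z.2)) (U ×ˢ U) :=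
      ContinuousOn.inner (𝕜 := ℝ) (h.cont.comp continuousOn_fst fun z hz => hz.1)
        (h.cont.comp continuousOn_snd fun z hz => hz.2)
    have := hc.measurable_piecewise (g := 0) continuous_zero.continuousOn
      (hU.prod hU).measurableSet
    rwa [piecewise_eq_indicator] at this
  have hf' : Measurable f' := by
    have hc : ContinuousOn (fun x => inner ℝ F (Φ x)) U :=
      ContinuousOn.inner (𝕜 := ℝ) continuousOn_const h.cont
    have := hc.measurable_piecewise (g := 0) continuous_zero.continuousOn hU.measurableSet
    rwa [piecewise_eq_indicator] at this
  refine (measurable_interpolant hK' hf').aestronglyMeasurable.congr ?_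
  filter_upwards [ae_prod_forall_mem P m hP] with z hz
  refine (interpolant_congr (U := U) (fun x hx y hy => ?_) (fun x hx => ?_) hz.1 hz.2).symm
  · simp only [K']
    rw [indicator_of_mem (mk_mem_prod hx hy), h.kernel x hx y hy]
  · simp only [f']
    rw [indicator_of_mem hx, h.eq x hx]

theorem memLp_interpolant (h : FeatureRep U K f Φ F B) (hU : IsOpen U) (hP : P Uᶜ = 0) (m : ℕ)
    (p : ENNReal) :
    MemLp (fun z : (Fin m → Euc d) × Euc d => interpolant K f z.1 z.2) p ((iidLaw P m).prod P) := by
  refine MemLp.of_bound (h.aestronglyMeasurable_interpolant hU hP m) (‖F‖ * B) ?_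
  filter_upwards [ae_prod_forall_mem P m hP] with z hz
  exact h.abs_interpolant_le hz.1 hz.2

theorem memLp_integral_interpolant (h : FeatureRep U K f Φ F B) (hU : IsOpen U) (hP : P Uᶜ = 0)
    (m : ℕ) (p : ENNReal) :
    MemLp (fun D₀ : Fin m → Euc d => ∫ x, interpolant K f D₀ x ∂P) p (iidLaw P m) := by
  refine MemLp.of_bound (h.aestronglyMeasurable_interpolant hU hP m).integral_prod_right'
    (‖F‖ * B) ?_
  filter_upwards [ae_iidLaw_forall_mem P m hP] with D₀ hD
  have := norm_integral_le_of_norm_le_const (μ := P) (C := ‖F‖ * B)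
    (f := fun x => interpolant K f D₀ x) (by
      filter_upwards [show ∀ᵐ x ∂P, x ∈ U from hP] with x hx
      exact h.abs_interpolant_le hD hx)
  simpa using this

theorem memLp_estimator (h : FeatureRep U K f Φ F B) (hU : IsOpen U) (hP : P Uᶜ = 0) (m l : ℕ)
    {p : ENNReal} (hf : MemLp f p P) :
    MemLp (fun D : (Fin m → Euc d) × (Fin l → Euc d) => estimator P K f D.1 D.2) p
      ((iidLaw P m).prod (iidLaw P l)) := by
  have he : ∀ i : Fin l, MeasurePreserving (fun D : (Fin m → Euc d) × (Fin l → Euc d) => D.2 i)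
      ((iidLaw P m).prod (iidLaw P l)) P := fun i =>
    (iidLaw_measurePreserving_eval P i).comp measurePreserving_snd
  have he' : ∀ i : Fin l,
      MeasurePreserving (fun D : (Fin m → Euc d) × (Fin l → Euc d) => (D.1, D.2 i))
      ((iidLaw P m).prod (iidLaw P l)) ((iidLaw P m).prod P) := fun i =>
    (MeasurePreserving.id (iidLaw P m)).prod (iidLaw_measurePreserving_eval P i)
  have hs : ∀ i : Fin l, MemLp (fun D : (Fin m → Euc d) × (Fin l → Euc d) =>
      f (D.2 i) - (interpolant K f D.1 (D.2 i) - ∫ x, interpolant K f D.1 x ∂P)) p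
      ((iidLaw P m).prod (iidLaw P l)) := fun i =>
    (hf.comp_measurePreserving (he i)).sub
      (((h.memLp_interpolant hU hP m p).comp_measurePreserving (he' i)).sub
        ((h.memLp_integral_interpolant hU hP m p).comp_measurePreserving measurePreserving_fst))
  exact (memLp_finsetSum _ fun i _ => hs i).const_mul _

end FeatureRep

/-! ### Bias and variance for a fixed design -/

section FixedDesign

variable {d : ℕ} {P : Measure (Euc d)} [IsProbabilityMeasure P] {l : ℕ}

theorem integrable_average {g : Euc d → ℝ} (hg : Integrable g P) :
    Integrable (fun D : Fin l → Euc d => (l : ℝ)⁻¹ * ∑ i, g (D i)) (iidLaw P l) :=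
  (integrable_finsetSum _ fun i _ =>
    (iidLaw_measurePreserving_eval P i).integrable_comp_of_integrable hg).const_mul _

theorem integral_average (hl : l ≠ 0) {g : Euc d → ℝ} (hg : Integrable g P) :
    ∫ D : Fin l → Euc d, (l : ℝ)⁻¹ * ∑ i, g (D i) ∂(iidLaw P l) = ∫ x, g x ∂P := by
  have hint : ∀ i : Fin l, Integrable (fun D : Fin l → Euc d => g (D i)) (iidLaw P l) := fun i =>
    (iidLaw_measurePreserving_eval P i).integrable_comp_of_integrable hg
  rw [integral_const_mul, integral_finsetSum _ fun i _ => hint i]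
  have : ∀ i : Fin l, ∫ D : Fin l → Euc d, g (D i) ∂(iidLaw P l) = ∫ x, g x ∂P := fun i => by
    have hmp := iidLaw_measurePreserving_eval P i
    have := integral_map (μ := iidLaw P l) hmp.aemeasurable (f := g)
      (by rw [hmp.map_eq]; exact hg.1)
    rw [hmp.map_eq] at this
    exact this.symm
  simp only [this]
  rw [Finset.sum_const, Finset.card_univ, Fintype.card_fin, nsmul_eq_mul, ← mul_assoc,
    inv_mul_cancel₀ (by exact_mod_cast hl), one_mul]

open ProbabilityTheory in
-- The left side is the variance of an average of l independent terms, at most E g²/l. The constant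
-- c cancels; it will be ∫ f_m.
theorem integral_sq_average_sub_le (hl : l ≠ 0) {g : Euc d → ℝ} (hg : MemLp g 2 P) (c : ℝ) :
    ∫ D : Fin l → Euc d, ((l : ℝ)⁻¹ * ∑ i, (g (D i) + c) - (∫ x, g x ∂P + c)) ^ 2 ∂(iidLaw P l)
      ≤ (l : ℝ)⁻¹ * ∫ x, g x ^ 2 ∂P := by
  have hl' : (l : ℝ) ≠ 0 := by exact_mod_cast hl
  set A : (Fin l → Euc d) → ℝ := fun D => (l : ℝ)⁻¹ * ∑ i, g (D i)
  have hA : AEMeasurable A (iidLaw P l) :=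
    (integrable_average (hg.integrable one_le_two)).aestronglyMeasurable.aemeasurable
  have e : ∀ D : Fin l → Euc d, (l : ℝ)⁻¹ * ∑ i, (g (D i) + c) - (∫ x, g x ∂P + c)
      = A D - ∫ D, A D ∂(iidLaw P l) := fun D => by
    rw [integral_average hl (hg.integrable one_le_two), Finset.sum_add_distrib, Finset.sum_const,
      Finset.card_univ, Fintype.card_fin, nsmul_eq_mul, mul_add, ← mul_assoc,
      inv_mul_cancel₀ hl', one_mul]
    ring
  simp only [e]
  rw [← variance_eq_integral hA, variance_const_mul]
  have hv : Var[fun D : Fin l → Euc d => ∑ i, g (D i); iidLaw P l] = l * Var[g; P] := by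
    have := variance_sum_pi (μ := fun _ : Fin l => P) (X := fun _ => g) (fun _ => hg)
    rw [iidLaw]
    convert this using 1
    · congr 1; ext D; simp
    · simp
  rw [hv]
  calc (l : ℝ)⁻¹ ^ 2 * (l * Var[g; P]) = (l : ℝ)⁻¹ * Var[g; P] := by field_simp
    _ ≤ _ := by
      gcongr
      exact variance_le_expectation_sq hg.aestronglyMeasurable

end FixedDesign

theorem estimator_unbiased {d m l : ℕ} {P : Measure (Euc d)} [IsProbabilityMeasure P] (hl : l ≠ 0)
    {K : Euc d → Euc d → ℝ} {f : Euc d → ℝ} (hf : Integrable f P) {D₀ : Fin m → Euc d}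
    (hK : Integrable (interpolant K f D₀) P) :
    Integrable (fun D₁ : Fin l → Euc d => estimator P K f D₀ D₁) (iidLaw P l) ∧
      ∫ D₁ : Fin l → Euc d, estimator P K f D₀ D₁ ∂(iidLaw P l) = ∫ x, f x ∂P := by
  have h0 : Integrable (fun x => interpolant K f D₀ x - ∫ x, interpolant K f D₀ x ∂P) P :=
    hK.sub (integrable_const _)
  have hg : Integrable (fun x => f x - (interpolant K f D₀ x - ∫ x, interpolant K f D₀ x ∂P)) P :=
    hf.sub h0
  refine ⟨integrable_average hg, (integral_average hl hg).trans ?_⟩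
  rw [integral_sub hf h0, integral_sub hK (integrable_const _)]
  simp

theorem integrable_of_continuousOn_compact {d : ℕ} {P : Measure (Euc d)} [IsFiniteMeasure P]
    {S : Set (Euc d)} (hS : IsCompact S) (hP : P Sᶜ = 0) {g : Euc d → ℝ} (hg : ContinuousOn g S) :
    Integrable g P := by
  have := hg.integrableOn_compact (μ := P) hS
  rwa [IntegrableOn, Measure.restrict_eq_self_of_ae_mem (show ∀ᵐ x ∂P, x ∈ S from hP)] at this

/-- Conditional unbiasedness allows design points on the boundary, where the feature map is not
available, so continuity comes directly from the derivatives of k within S. -/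
theorem continuousOn_kPlus_left {d n a : ℕ} {S : Set (Euc d)} (hS : UniqueDiffOn ℝ S)
    {k : Euc d → Euc d → ℝ} (hk : IsC2 (n + 1) S k) {p : Euc d → ℝ}
    (hp : ContDiffOn ℝ ((a + 1 : ℕ) : WithTop ℕ∞) p S) (hpos : ∀ x ∈ S, 0 < p x) (c : ℝ)
    {y : Euc d} (hy : y ∈ S) : ContinuousOn (fun x => kPlus S p k c x y) S := by
  have hs : ∀ i, ContinuousOn (score S p i) S := fun i => (contDiffOn_score hS hp hpos i).continuousOn
  have hk0 : ContDiffOn ℝ ((n + 1 : ℕ) : WithTop ℕ∞) (fun x => k x y) S := by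
    have := hk.diff_fst 0 (Nat.zero_le _) y hy
    exact (this.continuousLinearMap_comp
      (ContinuousMultilinearMap.apply ℝ (fun _ : Fin 0 => Euc d) ℝ 0)).congr fun x _ => by simp
  have hk1 : ∀ i, ContDiffOn ℝ ((n + 1 : ℕ) : WithTop ℕ∞) (fun x => pderiv S i (fun v => k x v) y) S := by
    intro i
    have := hk.diff_fst 1 (by omega) y hy
    refine (this.continuousLinearMap_comp (ContinuousMultilinearMap.apply ℝ
      (fun _ : Fin 1 => Euc d) ℝ (fun _ => EuclideanSpace.single i 1))).congr fun x _ => ?_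
    simp [pderiv, iteratedFDerivWithin_one_apply (hS y hy)]
  have hpd : ∀ {g : Euc d → ℝ}, ContDiffOn ℝ ((n + 1 : ℕ) : WithTop ℕ∞) g S → ∀ i,
      ContinuousOn (fun x => pderiv S i g x) S := fun hg i =>
    (hg.continuousOn_fderivWithin hS (by simp)).clm_apply continuousOn_const
  refine continuousOn_const.add (continuousOn_finsetSum _ fun i _ => ?_)
  exact (((hpd (hk1 i) i).add ((hs i).mul (hk1 i).continuousOn)).add
    (continuousOn_const.mul (hpd hk0 i))).add (((hs i).mul continuousOn_const).mul hk0.continuousOn)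

theorem integrable_interpolant {d m : ℕ} {P : Measure (Euc d)} [IsFiniteMeasure P]
    {K : Euc d → Euc d → ℝ} (f : Euc d → ℝ) {D₀ : Fin m → Euc d}
    (hK : ∀ i, Integrable (fun x => K x (D₀ i)) P) : Integrable (interpolant K f D₀) P := by
  by_cases hdet : IsUnit (gram K D₀).det
  · have : interpolant K f D₀ = fun x =>
        ∑ i, ((gram K D₀)⁻¹ *ᵥ fun j => f (D₀ j)) i * K x (D₀ i) := by
      funext x; rw [interpolant, if_pos hdet]
    rw [this]
    exact integrable_finsetSum _ fun i _ => (hK i).const_mul _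
  · have : interpolant K f D₀ = fun _ => 0 := by
      funext x; rw [interpolant, if_neg hdet]
    rw [this]
    exact integrable_const _

theorem bddAbove_fillDist {d m : ℕ} {X : Set (Euc d)} (hX : Bornology.IsBounded X) (hm : 1 ≤ m)
    (D₀ : Fin m → Euc d) : BddAbove (range fun x : X => ⨅ i : Fin m, ‖(x : Euc d) - D₀ i‖) := by
  obtain ⟨M, hM⟩ := hX.exists_norm_le
  refine ⟨M + ‖D₀ ⟨0, hm⟩‖, ?_⟩
  rintro _ ⟨x, rfl⟩
  refine (ciInf_le ⟨0, by rintro _ ⟨i, rfl⟩; exact norm_nonneg _⟩ ⟨0, hm⟩).trans ?_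
  exact (norm_sub_le _ _).trans (by gcongr; exact hM x x.2)

/-- A sublevel set with ≤ is an intersection over X, possibly uncountable, of finite unions of
closed sets, hence closed; the strict one is a countable union of these. -/
theorem measurableSet_fillDist_lt {d m : ℕ} {X : Set (Euc d)} (hX : Bornology.IsBounded X)
    (hXne : X.Nonempty) (hm : 1 ≤ m) (h : ℝ) :
    MeasurableSet {D₀ : Fin m → Euc d | fillDist X D₀ < h} := by
  have : Nonempty X := hXne.to_subtype
  have : Nonempty (Fin m) := ⟨⟨0, hm⟩⟩
  have hcl : ∀ t : ℝ, MeasurableSet {D₀ : Fin m → Euc d | fillDist X D₀ ≤ t} := by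
    intro t
    have : {D₀ : Fin m → Euc d | fillDist X D₀ ≤ t}
        = ⋂ x : X, ⋃ i : Fin m, {D₀ | ‖(x : Euc d) - D₀ i‖ ≤ t} := by
      ext D₀
      simp only [mem_ofPred_eq, mem_iInter, mem_iUnion]
      refine ⟨fun hle x => ?_, fun hx => ciSup_le fun x => ?_⟩
      · obtain ⟨i, hi⟩ := exists_eq_ciInf_of_finite (f := fun i : Fin m => ‖(x : Euc d) - D₀ i‖)
        exact ⟨i, hi.trans_le ((le_ciSup (bddAbove_fillDist hX hm D₀) x).trans hle)⟩
      · obtain ⟨i, hi⟩ := hx x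
        exact (ciInf_le ⟨0, by rintro _ ⟨i, rfl⟩; exact norm_nonneg _⟩ i).trans hi
    rw [this]
    refine (isClosed_iInter fun x => isClosed_iUnion_of_finite fun i => ?_).measurableSet
    exact isClosed_le (by fun_prop) continuous_const
  have : {D₀ : Fin m → Euc d | fillDist X D₀ < h}
      = ⋃ q : ℚ, ⋃ (_ : (q : ℝ) < h), {D₀ : Fin m → Euc d | fillDist X D₀ ≤ q} := by
    ext D₀
    simp only [mem_ofPred_eq, mem_iUnion, exists_prop]
    refine ⟨fun hlt => ?_, fun ⟨q, hq, hle⟩ => hle.trans_lt hq⟩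
    obtain ⟨q, hq1, hq2⟩ := exists_rat_btwn hlt
    exact ⟨q, hq2, hq1.le⟩
  rw [this]
  exact MeasurableSet.iUnion fun q => MeasurableSet.iUnion fun _ => hcl q

/-! ### The mean square error bound -/

namespace FeatureRep

variable {d : ℕ} {G : Type*} [NormedAddCommGroup G] [InnerProductSpace ℝ G]
  {U : Set (Euc d)} {K : Euc d → Euc d → ℝ} {f : Euc d → ℝ} {Φ : Euc d → G} {F : G} {B : ℝ}
  {P : Measure (Euc d)} [IsProbabilityMeasure P]

theorem ae_memLp_interpolant (h : FeatureRep U K f Φ F B) (hU : IsOpen U) (hP : P Uᶜ = 0) (m : ℕ)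
    (p : ENNReal) : ∀ᵐ D₀ ∂(iidLaw P m), MemLp (interpolant K f D₀) p P := by
  filter_upwards [ae_iidLaw_forall_mem P m hP,
    (h.aestronglyMeasurable_interpolant hU hP m).prodMk_left] with D₀ hD hmeas
  refine MemLp.of_bound hmeas (‖F‖ * B) ?_
  filter_upwards [show ∀ᵐ x ∂P, x ∈ U from hP] with x hx
  exact h.abs_interpolant_le hD hx

theorem integral_estimator (h : FeatureRep U K f Φ F B) (hU : IsOpen U) (hP : P Uᶜ = 0) (m : ℕ)
    {l : ℕ} (hl : l ≠ 0) (hf : Integrable f P) :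
    ∫ D : (Fin m → Euc d) × (Fin l → Euc d), estimator P K f D.1 D.2
      ∂((iidLaw P m).prod (iidLaw P l)) = ∫ x, f x ∂P := by
  rw [integral_prod _ (memLp_one_iff_integrable.1
    (h.memLp_estimator hU hP m l (memLp_one_iff_integrable.2 hf)))]
  have : ∀ᵐ D₀ ∂(iidLaw P m), ∫ D₁ : Fin l → Euc d, estimator P K f D₀ D₁ ∂(iidLaw P l)
      = ∫ x, f x ∂P := by
    filter_upwards [h.ae_memLp_interpolant hU hP m 1] with D₀ hD
    exact (estimator_unbiased hl hf (memLp_one_iff_integrable.1 hD)).2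
  rw [integral_congr_ae this]
  simp

theorem integrable_sq_estimator_sub (h : FeatureRep U K f Φ F B) (hU : IsOpen U) (hP : P Uᶜ = 0)
    (m l : ℕ) (hf : MemLp f 2 P) (c : ℝ) :
    Integrable (fun D : (Fin m → Euc d) × (Fin l → Euc d) => (estimator P K f D.1 D.2 - c) ^ 2)
      ((iidLaw P m).prod (iidLaw P l)) :=
  ((h.memLp_estimator hU hP m l hf).sub (memLp_const c)).integrable_sq

/-- The mean square error is controlled by the mean square interpolation error. -/
theorem integral_sq_estimator_sub_le (h : FeatureRep U K f Φ F B) (hU : IsOpen U) (hP : P Uᶜ = 0)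
    (m : ℕ) {l : ℕ} (hl : l ≠ 0) (hf : MemLp f 2 P) :
    ∫ D : (Fin m → Euc d) × (Fin l → Euc d), (estimator P K f D.1 D.2 - ∫ x, f x ∂P) ^ 2
      ∂((iidLaw P m).prod (iidLaw P l))
      ≤ (l : ℝ)⁻¹ * ∫ x, ∫ D₀, (f x - interpolant K f D₀ x) ^ 2 ∂(iidLaw P m) ∂P := by
  have hsq := h.integrable_sq_estimator_sub hU hP m l hf (∫ x, f x ∂P)
  have hE : Integrable (fun z : (Fin m → Euc d) × Euc d => (f z.2 - interpolant K f z.1 z.2) ^ 2)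
      ((iidLaw P m).prod P) :=
    ((hf.comp_measurePreserving measurePreserving_snd).sub
      (h.memLp_interpolant hU hP m 2)).integrable_sq
  have hswap : ∫ x, ∫ D₀, (f x - interpolant K f D₀ x) ^ 2 ∂(iidLaw P m) ∂P
      -- The variance bound integrates over x first, the design estimate over D₀ first at fixed x;
      -- Fubini connects them.
      = ∫ D₀, ∫ x, (f x - interpolant K f D₀ x) ^ 2 ∂P ∂(iidLaw P m) :=
    (integral_integral_swap hE).symm
  rw [integral_prod _ hsq, hswap, ← integral_const_mul]
  refine integral_mono_ae hsq.integral_prod_left (hE.integral_prod_left.const_mul _) ?_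
  filter_upwards [h.ae_memLp_interpolant hU hP m 2] with D₀ hD
  have hfi := hf.integrable one_le_two
  have hDi := hD.integrable one_le_two
  have := integral_sq_average_sub_le hl (hf.sub hD) (∫ x, interpolant K f D₀ x ∂P)
  simp only [Pi.sub_apply] at this
  rw [integral_sub hfi hDi, sub_add_cancel] at this
  simpa only [estimator, sub_add] using this

end FeatureRep

/-- By compactness the density has a positive minimum, so every reference ball at scale R has mass
at least q R^d with q independent of x. The pointwise estimate is then uniform and integrates over
x. -/
theorem exists_mse_bound {d : ℕ} (hd : 0 < d) {S : Set (Euc d)} (hSc : IsCompact S) {ρ r : ℝ}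
    (hρ : 0 < ρ) (hr : 0 < r) (hcone : HasConeBalls S ρ r) {p : Euc d → ℝ}
    [IsProbabilityMeasure (law S p)] (hp : ContinuousOn p S) (hpos : ∀ x ∈ S, 0 < p x)
    {G : Type*} [NormedAddCommGroup G] [InnerProductSpace ℝ G] {K : Euc d → Euc d → ℝ}
    {f : Euc d → ℝ} {Φ : Euc d → G} {F : G} {B : ℝ} {s : ℕ}
    (hrep : FeatureRep (interior S) K f Φ F B) (hΦ : BddContDiffOn s Φ (interior S))
    (hf : MemLp f 2 (law S p))
    (hdet : ∀ m : ℕ, ∀ᵐ D₀ ∂(iidLaw (law S p) m), IsUnit (gram K D₀).det) {ε : ℝ} (hε : 0 < ε) :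
    ∃ C : ℝ, ∀ m l : ℕ, 1 ≤ m → l ≠ 0 →
      ∫ D : (Fin m → Euc d) × (Fin l → Euc d), (estimator (law S p) K f D.1 D.2
          - ∫ x, f x ∂(law S p)) ^ 2 ∂((iidLaw (law S p) m).prod (iidLaw (law S p) l))
        ≤ C * (l : ℝ)⁻¹ * (m : ℝ) ^ (-2 * (s : ℝ) / d + ε) := by
  set P := law S p with hPdef
  have hP : P (interior S)ᶜ = 0 := law_compl_of_null hSc.measurableSet
    (hcone.volume_diff_interior hρ hr hSc.isClosed) p
  obtain ⟨δ, hδ, C, hdes⟩ := hcone.exists_isLocalDesign s hρ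
  obtain ⟨M, hM⟩ := hΦ.bdd s le_rfl
  have hSne : S.Nonempty := by
    by_contra hne
    rw [not_nonempty_iff_eq_empty] at hne
    have : P univ = 0 := by simp [hPdef, law, hne]
    simp at this
  obtain ⟨x₀, hx₀, hmin⟩ := hSc.exists_isMinOn hSne hp
  set q := p x₀ * (volume (ball (0 : Euc d) δ)).toReal with hq
  have hq0 : 0 < q := mul_pos (hpos x₀ hx₀)
    (ENNReal.toReal_pos (measure_ball_pos _ _ hδ).ne' measure_ball_lt_top.ne)
  obtain ⟨A, hA⟩ := exists_rate hd s hr hq0 (C₁ := (‖F‖ * ((1 + C) * M)) ^ 2)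
    (C₂ := (‖F‖ * B) ^ 2 * Fintype.card (Fin d → Fin s)) (by positivity) (by positivity) hε
  refine ⟨A, fun m l hm hl => ?_⟩
  obtain ⟨R, hR, hRr, hle⟩ := hA m hm
  refine (hrep.integral_sq_estimator_sub_le isOpen_interior hP m hl hf).trans ?_
  rw [mul_comm A, mul_assoc]
  gcongr
  refine le_trans ?_ hle
  have hpt : ∀ᵐ x ∂P, ∫ D₀, (f x - interpolant K f D₀ x) ^ 2 ∂(iidLaw P m)
      ≤ (‖F‖ * ((1 + C) * M)) ^ 2 * R ^ (2 * s)
        + (‖F‖ * B) ^ 2 * Fintype.card (Fin d → Fin s) * Real.exp (-(m * (q * R ^ d))) := by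
    filter_upwards [show ∀ᵐ x ∂P, x ∈ interior S from hP] with x hx
    obtain ⟨y₀, hy₀⟩ := hdes x (interior_subset hx)
    exact hy₀.integral_sq_sub_interpolant_le hrep hΦ.contDiffOn hM hx hR hRr P hP (hdet m)
      fun j => le_law_ball (fun x hx => hmin hx) hR
        ((hy₀.ball_subset hR hRr j).trans interior_subset)
  calc _ ≤ ∫ _x, _ ∂P := integral_mono_of_nonneg
        (ae_of_all _ fun x => integral_nonneg fun _ => sq_nonneg _) (integrable_const _) hpt
    _ = _ := by simp

end SteinCF

/-! ### The main theorem -/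

theorem theorem1 {d : ℕ} (hd : 0 < d)
    (X : Set (Euc d)) (hXopen : IsOpen X) (hXbdd : Bornology.IsBounded X)
    -- the target distribution `P` with density `p` on the closure of `X`
    (P : Measure (Euc d)) [IsProbabilityMeasure P] (p : Euc d → ℝ) (hP : P = law (closure X) p)
    -- the RKHS on the closure of `X`
    (H : Type*) [NormedAddCommGroup H] [InnerProductSpace ℝ H] [CompleteSpace H]
    [RKHS ℝ H (closure X) ℝ]
    (a b : ℕ) (c : ℝ) (hc : 0 < c)
    (hA1 : ContDiffOn ℝ ((a + 1 : ℕ) : WithTop ℕ∞) p (closure X))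
    (hA2 : ClassQ X p)
    (hA3 : IsC2 (b + 1) (closure X) (ker (closure X) H))
    (hA4 : ClassR X (ker (closure X) H) p)
    (hA5 : ∀ x ∈ closure X, 0 < p x)
    (f : Euc d → ℝ) (hf : MemLp f 2 P)
    (hA6 : MemHPlus (closure X) p H f)
    (hA7 : InteriorCone (closure X)) :
    -- unbiasedness, conditionally on `D₀` and unconditionally
    (∀ m n : ℕ, 1 ≤ m → m < n →
      (∀ D₀ : Fin m → Euc d, (∀ i, D₀ i ∈ closure X) →
        Integrable (fun D₁ : Fin (n - m) → Euc d =>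
          estimator P (kPlus (closure X) p (ker (closure X) H) c) f D₀ D₁) (iidLaw P (n - m)) ∧
        ∫ D₁ : Fin (n - m) → Euc d,
          estimator P (kPlus (closure X) p (ker (closure X) H) c) f D₀ D₁ ∂(iidLaw P (n - m))
            = ∫ x, f x ∂P) ∧
      Integrable (fun D : (Fin m → Euc d) × (Fin (n - m) → Euc d) =>
        estimator P (kPlus (closure X) p (ker (closure X) H) c) f D.1 D.2)
          ((iidLaw P m).prod (iidLaw P (n - m))) ∧
      ∫ D : (Fin m → Euc d) × (Fin (n - m) → Euc d),
        estimator P (kPlus (closure X) p (ker (closure X) H) c) f D.1 D.2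
          ∂((iidLaw P m).prod (iidLaw P (n - m))) = ∫ x, f x ∂P) ∧
    -- the mean square error, when the kernel matrix is almost surely nonsingular
    ((∀ m : ℕ, ∀ᵐ D₀ ∂(iidLaw P m),
        IsUnit (gram (kPlus (closure X) p (ker (closure X) H) c) D₀).det) →
      ∃ h : ℝ, 0 < h ∧ ∀ ε : ℝ, 0 < ε → ∃ C : ℝ, ∀ m n : ℕ, 1 ≤ m → m < n →
        Integrable ({D : (Fin m → Euc d) × (Fin (n - m) → Euc d) | fillDist X D.1 < h}.indicator
          fun D => (estimator P (kPlus (closure X) p (ker (closure X) H) c) f D.1 D.2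
            - ∫ x, f x ∂P) ^ 2) ((iidLaw P m).prod (iidLaw P (n - m))) ∧
        ∫ D : (Fin m → Euc d) × (Fin (n - m) → Euc d),
          {D : (Fin m → Euc d) × (Fin (n - m) → Euc d) | fillDist X D.1 < h}.indicator
            (fun D => (estimator P (kPlus (closure X) p (ker (closure X) H) c) f D.1 D.2
              - ∫ x, f x ∂P) ^ 2) D ∂((iidLaw P m).prod (iidLaw P (n - m)))
          ≤ C * ((n : ℝ) - (m : ℝ))⁻¹ * (m : ℝ) ^ (-2 * (min a b : ℝ) / (d : ℝ) + ε)) := by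
  have hSc : IsCompact (closure X) := hXbdd.isCompact_closure
  obtain ⟨ρ, hρ, r, hr, hcone⟩ := hA7.hasConeBalls
  have hSu : UniqueDiffOn ℝ (closure X) := hcone.uniqueDiffOn hρ hr
  subst hP
  have hPS : law (closure X) p (closure X)ᶜ = 0 := law_compl hSc.measurableSet p
  have hPU : law (closure X) p (interior (closure X))ᶜ = 0 := law_compl_of_null hSc.measurableSet
    (hcone.volume_diff_interior hρ hr hSc.isClosed) p
  obtain ⟨Φ, F, B, hΦ, hrep⟩ := exists_featureRep hSu hSc hc hA1 hA5 hA3 hA6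
  have hf1 : Integrable f (law (closure X) p) := hf.integrable one_le_two
  -- Any positive threshold would do, here 1: the bound holds without the indicator, and inserting
  -- it only decreases the integral of a nonnegative function.
  refine ⟨fun m n _ hmn => ?_, fun hdet => ⟨1, one_pos, fun ε hε => ?_⟩⟩
  · have hl : n - m ≠ 0 := Nat.sub_ne_zero_of_lt hmn
    refine ⟨fun D₀ hD => estimator_unbiased hl hf1 (integrable_interpolant f fun i => ?_), ?_,
      hrep.integral_estimator isOpen_interior hPU m hl hf1⟩
    · exact integrable_of_continuousOn_compact hSc hPS
        (continuousOn_kPlus_left hSu hA3 hA1 hA5 c (hD i))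
    · exact memLp_one_iff_integrable.1
        (hrep.memLp_estimator isOpen_interior hPU m _ (memLp_one_iff_integrable.2 hf1))
  · obtain ⟨C, hC⟩ := exists_mse_bound hd hSc hρ hr hcone hA1.continuousOn hA5 hrep hΦ hf hdet hε
    refine ⟨C, fun m n hm hmn => ?_⟩
    have hl : n - m ≠ 0 := Nat.sub_ne_zero_of_lt hmn
    have hXne : X.Nonempty := by
      by_contra hne
      rw [not_nonempty_iff_eq_empty] at hne
      have : law (closure X) p univ = 0 := by simp [hne, law]
      simp at this
    have hint := hrep.integrable_sq_estimator_sub isOpen_interior hPU m (n - m) hf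
      (∫ x, f x ∂(law (closure X) p))
    have hmeas : MeasurableSet
        {D : (Fin m → Euc d) × (Fin (n - m) → Euc d) | fillDist X D.1 < 1} :=
      measurable_fst (measurableSet_fillDist_lt hXbdd hXne hm 1)
    refine ⟨hint.indicator hmeas, ?_⟩
    refine (integral_mono (hint.indicator hmeas) hint
      (indicator_le_self' fun _ _ => sq_nonneg _)).trans ?_
    have := hC m (n - m) hm hl
    rwa [Nat.cast_sub hmn.le, Nat.cast_min] at this
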